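/- Let $K$ be an imperfect field of characteristic $2$, and let $L$ be an additive subgroup of $K$ with $K^2\le L\le K$ which is a vector space over $K^2$. Let $\mathrm{SL}_2(L)\le \mathrm{SL}_2(K)$ be the subgroup generated by the matrices $a(t)=\begin{pmatrix}1&t\\0&1\end{pmatrix}$ and $b(t)=\begin{pmatrix}1&0\\t&1\end{pmatrix}$ with $t\in L$. Write $L^*=L\setminus\{0\}$, let $\langle L^*\rangle\le K^\times$ be the multiplicative group generated by $L^*$, let $T(K)$ be the group of all diagonal matrices in $\mathrm{SL}_2(K)$, and let $T(L)=\{\mathrm{Diag}(t,t^{-1}) : t\in\langle L^*\rangle\}$. For a group $T$ with $T(L)\le T\le T(K)$, let $T\,\mathrm{SL}_2(L)$ be the product, which is a subgroup of $\mathrm{SL}_2(K)$, and let $\bar T$ be the set of $c\in K$ such that multiplication by $c$ on $L$ is induced by conjugation by some $h\in T$, i.e. $h\,a(t)\,h^{-1}=a(ct)$ for all $t\in L$. Let $K_1=\{a\in K : aL\le L\}$, which is a subfield of $K$ containing $K^2$, and let $\tilde K=K_1^{1/2}$ be the field of square roots of elements of $K_1$ in an algebraic closure of $K$, so that $L\le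 K\le\tilde K$. A first-order structure is called stable if no formula $\varphi(\bar x;\bar y)$ has the order property in its complete theory. (a) For every such $T$ we have $\bar T\subseteq L$, and the following are equivalent: 1. the group $T\,\mathrm{SL}_2(L)$ is stable; 2. the structure $(L,\bar T,\cdot,\sigma)$ is stable, that is, the additive group $L$ with the subset $\bar T\subseteq L$, the multiplication $\cdot$ on $\bar T$, and the squaring map $\sigma$ on $L$ (which takes $L^*$ into $\bar T$); 3. the structure $(\tilde K,L,\bar T)$, that is, the field $\tilde K$ with predicates for $L$ and $\bar T$, is stable. Moreover, the field $\tilde K$ is definable without parameters in $(L,\bar T,\cdot,\sigma)$ through the squaring map $\tilde K\to L$, $x\mapsto x^2$, which is a bijection onto $K_1\subseteq L$. (b) The group of diagonal matrices in $\mathrm{SL}_2(L)$ is $T(L)$, and $T(L)\,\mathrm{SL}_2(L)=\mathrm{SL}_2(L)$. If $T=T(L)$, then $\bar T=\{u^2 : u\in\langle L^*\rangle\}$; and in the third structure $\bar T$ may be taken to be the subgroup of $\tilde K^\times$ generated by $L^*$: the group $\mathrm{SL}_2(L)$ is stable if and only if $(\tilde K,L,\langle L^*\rangle)$ is stable. (c)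 The field $\tilde K$ is imperfect, $\tilde K^2\le L\le\tilde K$, $L$ is a vector space over $\tilde K^2$, and the group $\mathrm{SL}_2(L)$ formed in $\mathrm{SL}_2(K)$ is the same as the group $\mathrm{SL}_2(L)$ formed in $\mathrm{SL}_2(\tilde K)$. -/

import Mathlib

open FirstOrder

/-! ### Stability of first-order structures -/

/-- A structure is stable when no formula `φ(x̄; ȳ)` of its language admits arbitrarily long finite
ladders `ā₀, …, ā_{N-1}; b̄₀, …, b̄_{N-1}` with `φ(āᵢ; b̄ⱼ) ↔ i ≤ j`. The existence of a ladder of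
a given length is a first-order sentence, so this is a property of the complete theory; it says that
no formula has the order property in that theory. -/
def IsStable {𝓛 : Language} {M : Type*} (S : 𝓛.Structure M) : Prop :=
  ∀ (m n : ℕ) (φ : 𝓛.Formula (Fin m ⊕ Fin n)), ∃ N : ℕ,
    ¬ ∃ (a : Fin N → Fin m → M) (b : Fin N → Fin n → M),
      ∀ i j : Fin N, φ.Realize (Sum.elim (a i) (b j)) ↔ i ≤ j

/-- The map `e : F → M` exhibits the field `F` as a field definable without parameters in the
structure `S` on `M`: it is injective, and its image and the images of the graphs of addition and
multiplication are definable. -/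
def DefinesField {𝓛 : Language} {M : Type*} (S : 𝓛.Structure M) {F : Type*} [Field F]
    (e : F → M) : Prop :=
  Function.Injective e ∧
  (∅ : Set M).Definable 𝓛 {v : Fin 1 → M | ∃ x, v 0 = e x} ∧
  (∅ : Set M).Definable 𝓛 {v : Fin 3 → M | ∃ x y, v 0 = e x ∧ v 1 = e y ∧ v 2 = e (x + y)} ∧
  (∅ : Set M).Definable 𝓛 {v : Fin 3 → M | ∃ x y, v 0 = e x ∧ v 1 = e y ∧ v 2 = e (x * y)}

/-! ### Groups as structures -/

inductive GroupFunc : ℕ → Type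
  | one : GroupFunc 0
  | inv : GroupFunc 1
  | mul : GroupFunc 2

/-- The language of groups. -/
def groupLang : Language := ⟨GroupFunc, fun _ => Empty⟩

/-- A group as a structure in the language of groups. -/
@[reducible]
def groupStructure (G : Type*) [Group G] : groupLang.Structure G where
  funMap
    | GroupFunc.one, _ => 1
    | GroupFunc.inv, v => (v 0)⁻¹
    | GroupFunc.mul, v => v 0 * v 1
  RelMap r := r.elim

/-! ### Fields with two unary predicates -/

inductive PredPair : ℕ → Type
  | fst : PredPair 1
  | snd : PredPair 1

/-- The language of rings with two additional unary predicates. -/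
def fieldPairLang : Language := ⟨ringFunc, PredPair⟩

/-- The structure `(F, P, Q)`: the field `F` with predicates for the subsets `P` and `Q`. -/
@[reducible]
def fieldPairStructure (F : Type*) [Field F] (P Q : Set F) : fieldPairLang.Structure F where
  funMap
    | ringFunc.zero, _ => 0
    | ringFunc.one, _ => 1
    | ringFunc.neg, v => -v 0
    | ringFunc.add, v => v 0 + v 1
    | ringFunc.mul, v => v 0 * v 1
  RelMap
    | PredPair.fst, v => v 0 ∈ P
    | PredPair.snd, v => v 0 ∈ Q

/-! ### The setting -/

/-- An additive subgroup `L` of a field `K` of characteristic `2` with `K² ≤ L ≤ K` that is a vector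
space over `K²`. -/
structure Timmesfeld (K : Type*) [Field K] [CharP K 2] where
  L : AddSubgroup K
  sq_mem (a : K) : a ^ 2 ∈ L
  sq_mul_mem (a : K) {x : K} (hx : x ∈ L) : a ^ 2 * x ∈ L

/-- `SL₂(F)`. -/
abbrev SLTwo (F : Type*) [Field F] : Type _ := Matrix.SpecialLinearGroup (Fin 2) F

/-- The upper unitriangular matrix with entry `t`. -/
def upperUni {F : Type*} [Field F] (t : F) : SLTwo F := ⟨!![1, t; 0, 1], by simp⟩

/-- The lower unitriangular matrix with entry `t`. -/
def lowerUni {F : Type*} [Field F] (t : F) : SLTwo F := ⟨!![1, 0; t, 1], by simp⟩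

/-- The homomorphism `t ↦ Diag(t, t⁻¹)`. -/
def diagHom (F : Type*) [Field F] : Fˣ →* SLTwo F where
  toFun t := ⟨!![(t : F), 0; 0, ((t⁻¹ : Fˣ) : F)], by simp⟩
  map_one' := Subtype.ext (by simp [Matrix.one_fin_two])
  map_mul' s t := Subtype.ext (by
    change _ = !![(s : F), 0; 0, ((s⁻¹ : Fˣ) : F)] * !![(t : F), 0; 0, ((t⁻¹ : Fˣ) : F)]
    simp [mul_comm])

/-- `T(F)`, the group of all diagonal matrices in `SL₂(F)`. -/
def fullTorus (F : Type*) [Field F] : Subgroup (SLTwo F) := (diagHom F).range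

namespace Timmesfeld

variable {K : Type*} [Field K] [CharP K 2] (D : Timmesfeld K)

/-- `SL₂(L)`: the subgroup of `SL₂(K)` generated by the upper and the lower unitriangular matrices
with coefficients in `L`. -/
def SL2 : Subgroup (SLTwo K) := Subgroup.closure (upperUni '' D.L ∪ lowerUni '' D.L)

/-- The subgroup of `Kˣ` generated by the nonzero elements of `L`. -/
def unitsGen : Subgroup Kˣ := Subgroup.closure {u : Kˣ | (u : K) ∈ D.L}

/-- `T(L)`: the matrices `Diag(t, t⁻¹)` with `t` in the multiplicative group generated by the nonzero
elements of `L`. -/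
def torus : Subgroup (SLTwo K) := D.unitsGen.map (diagHom K)

/-- `T · SL₂(L)`, as the subgroup generated by `T` and `SL₂(L)`; for groups `T` of diagonal matrices
it is the product set, see `coe_group`. -/
def group (T : Subgroup (SLTwo K)) : Subgroup (SLTwo K) := T ⊔ D.SL2

/-- `T̄`: the `a ∈ K` such that multiplication by `a` on `L` is induced by an element of `T` acting by
conjugation on the group `A` of upper unitriangular matrices with coefficients in `L`. -/
def Tbar (T : Subgroup (SLTwo K)) : Set K :=
  {a | ∃ h ∈ T, ∀ t ∈ D.L, h * upperUni t * h⁻¹ = upperUni (a * t)}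

lemma one_mem : (1 : K) ∈ D.L := by simpa using D.sq_mem 1

/-- `K₁ = {a ∈ K | a L ≤ L}`, the multiplicative stabilizer of `L`. -/
def stabilizer : Subfield K where
  carrier := {a | ∀ x ∈ D.L, a * x ∈ D.L}
  mul_mem' {a b} ha hb x hx := by rw [mul_assoc]; exact ha _ (hb _ hx)
  one_mem' x hx := by simpa using hx
  add_mem' {a b} ha hb x hx := by rw [add_mul]; exact D.L.add_mem (ha _ hx) (hb _ hx)
  zero_mem' x _ := by simp [D.L.zero_mem]
  neg_mem' {a} ha x hx := by rw [neg_mul]; exact D.L.neg_mem (ha _ hx)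
  inv_mem' a ha x hx := by
    have h := D.sq_mul_mem a⁻¹ (ha x hx)
    by_cases h0 : a = 0
    · simp [h0, D.L.zero_mem]
    · have e : a⁻¹ ^ 2 * (a * x) = a⁻¹ * x := by field_simp
      rwa [e] at h

/-- `K̃ = K₁^{1/2}`: the field of all square roots of elements of `K₁` in an algebraic closure
of `K`. -/
noncomputable def tilde : Subfield (AlgebraicClosure K) :=
  (D.stabilizer.map (algebraMap K (AlgebraicClosure K))).comap (frobenius (AlgebraicClosure K) 2)

lemma mem_tilde {x : AlgebraicClosure K} :
    x ∈ D.tilde ↔ ∃ a ∈ D.stabilizer, algebraMap K (AlgebraicClosure K) a = x ^ 2 := by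
  simp [tilde, Subfield.mem_comap, Subfield.mem_map, frobenius_def]

/-- The inclusion of `K` in `K̃`. -/
noncomputable def incl : K →+* D.tilde :=
  (algebraMap K (AlgebraicClosure K)).codRestrict D.tilde fun a =>
    D.mem_tilde.2 ⟨a ^ 2, fun _ hx => D.sq_mul_mem a hx, map_pow _ _ _⟩

lemma exists_incl_eq_sq (x : D.tilde) : ∃ a ∈ D.stabilizer, D.incl a = x ^ 2 := by
  obtain ⟨a, ha, h⟩ := D.mem_tilde.1 x.2
  exact ⟨a, ha, Subtype.ext h⟩

/-- The group `L`, viewed inside the field `K̃`. -/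
noncomputable def overTilde : Timmesfeld D.tilde where
  L := D.L.map D.incl.toAddMonoidHom
  sq_mem x := by
    obtain ⟨a, ha, h⟩ := D.exists_incl_eq_sq x
    exact ⟨a, by simpa using ha 1 D.one_mem, h⟩
  sq_mul_mem x y hy := by
    obtain ⟨a, ha, h⟩ := D.exists_incl_eq_sq x
    obtain ⟨z, hz, rfl⟩ := hy
    exact ⟨a * z, ha z hz, by rw [← h]; exact map_mul D.incl a z⟩

lemma fullTorus_le_normalizer : fullTorus K ≤ Subgroup.normalizer (D.SL2 : Set (SLTwo K)) := by
  have key : ∀ (u : Kˣ) (g : SLTwo K), g ∈ D.SL2 →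
      diagHom K u * g * (diagHom K u)⁻¹ ∈ D.SL2 := by
    intro u g hg
    have hle : D.SL2 ≤ D.SL2.comap (MulAut.conj (diagHom K u)).toMonoidHom := by
      conv_lhs => rw [SL2]
      rw [Subgroup.closure_le]
      rintro _ (⟨t, ht, rfl⟩ | ⟨t, ht, rfl⟩)
      · refine Subgroup.subset_closure (Or.inl ⟨(u : K) ^ 2 * t, D.sq_mul_mem _ ht, ?_⟩)
        change _ = diagHom K u * upperUni t * (diagHom K u)⁻¹
        rw [← map_inv]
        refine Subtype.ext ?_
        change _ = !![(u : K), 0; 0, ((u⁻¹ : Kˣ) : K)] * !![1, t; 0, 1] *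
          !![((u⁻¹ : Kˣ) : K), 0; 0, ((u⁻¹⁻¹ : Kˣ) : K)]
        simp [upperUni]
        ring
      · refine Subgroup.subset_closure (Or.inr ⟨((u⁻¹ : Kˣ) : K) ^ 2 * t, D.sq_mul_mem _ ht, ?_⟩)
        change _ = diagHom K u * lowerUni t * (diagHom K u)⁻¹
        rw [← map_inv]
        refine Subtype.ext ?_
        change _ = !![(u : K), 0; 0, ((u⁻¹ : Kˣ) : K)] * !![1, 0; t, 1] *
          !![((u⁻¹ : Kˣ) : K), 0; 0, ((u⁻¹⁻¹ : Kˣ) : K)]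
        simp [lowerUni]
        ring
    exact hle hg
  rintro _ ⟨u, rfl⟩
  rw [Subgroup.mem_normalizer_iff]
  refine fun g => ⟨key u g, fun h => ?_⟩
  have := key u⁻¹ _ h
  rwa [map_inv, inv_inv, mul_assoc, mul_assoc, mul_assoc, inv_mul_cancel, mul_one,
    inv_mul_cancel_left] at this

lemma coe_group {T : Subgroup (SLTwo K)} (hT : T ≤ fullTorus K) :
    (D.group T : Set (SLTwo K)) = {g | ∃ h ∈ T, ∃ s ∈ D.SL2, g = h * s} := by
  ext g
  rw [group, Subgroup.coe_mul_of_left_le_normalizer_right T D.SL2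
    (hT.trans D.fullTorus_le_normalizer)]
  simp [Set.mem_mul, eq_comm]

end Timmesfeld

/-! ### The structure `(L, T̄, ·, σ)` -/

inductive CoordFunc : ℕ → Type
  | zero : CoordFunc 0
  | neg : CoordFunc 1
  | add : CoordFunc 2
  | sq : CoordFunc 1

inductive CoordRel : ℕ → Type
  | torus : CoordRel 1
  | mul : CoordRel 3

/-- The language with symbols for the additive group operations, for the squaring map, for the subset
`T̄`, and for the graph of the multiplication on `T̄`. -/
def coordLang : Language := ⟨CoordFunc, CoordRel⟩

/-- The structure `(L, T̄, ·, σ)`: the additive group `L` with the subset `T̄ ⊆ L`, the multiplication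
on `T̄`, and the squaring map on `L` (which maps nonzero elements into `T̄`, and `0` to `0`). -/
@[reducible]
def Timmesfeld.coordStructure {K : Type*} [Field K] [CharP K 2] (D : Timmesfeld K)
    (T : Subgroup (SLTwo K)) : coordLang.Structure D.L where
  funMap
    | CoordFunc.zero, _ => 0
    | CoordFunc.neg, v => -v 0
    | CoordFunc.add, v => v 0 + v 1
    | CoordFunc.sq, v => ⟨(v 0 : K) ^ 2, D.sq_mem _⟩
  RelMap
    | CoordRel.torus, v => (v 0 : K) ∈ D.Tbar T
    | CoordRel.mul, v =>
        (v 0 : K) ∈ D.Tbar T ∧ (v 1 : K) ∈ D.Tbar T ∧ (v 0 : K) * (v 1 : K) = v 2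

/-! ### Definable sets given by predicates -/

namespace Set

open FirstOrder FirstOrder.Language

variable {𝓛 : Language} {M : Type*} [𝓛.Structure M] {A : Set M} {α : Type*}

/-! Stability passes to interpreted structures (`IsInterpretation.isStable`), so the equivalence
follows from a cycle of interpretations with parameters: `(L, T̄, ·, σ)` in the group, the field
`K̃` with its predicates in `(L, T̄, ·, σ)`, and the group in the field. Characteristic 2 enters
throughout by the injectivity of squaring: an element of `T` is determined by the square by which it
acts on the unitriangular group `A ≅ L`, and `T̄` is the set of these squares.

Coordinates from the group: the centralizer of `a(1)` is `A`, and the centralizer of one nontrivial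
diagonal matrix is `T`. Hence `T̄` and its multiplication are read off from conjugation of `a(1)` by
elements of `T`. Squaring comes from the identity `a(x) b(x⁻¹) a(x) w = Diag(x, x⁻¹)`, where `w` is
the Weyl element: among the products `a(x) b(y) a(x) w` only `y = x⁻¹` gives a diagonal matrix, and
this one carries `a(1)` to `a(x²)`.

Field from the coordinates: for nonzero `x, y ∈ L` the relation `xy = z` is equivalent to `x²y² =
z²`, a statement about the multiplication on `T̄`. So multiplication on `L` is definable wherever
its values stay in `L`, in particular on `K₁`, which is itself definable. Squaring identifies `K̃`
with `K₁`, and `L ⊆ K̃` with `σ(L)`.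

Group from the field: the main computation, `mem_group_iff`, describes `T · SL₂(L)` inside `SL₂(K)`
by its entries. Each entry is zero or an eigenvalue of an element of `T`, and the products of two
entries in the same row or column lie in `L`. The conditions survive multiplication by generators,
and the Bruhat decomposition gives the converse. They also identify the diagonal subgroup of
`SL₂(L)`. For `T = T(L)` the predicates `T̄` and `⟨L*⟩` define each other by squaring. -/

lemma Definable.and {p q : (α → M) → Prop} (hp : A.Definable 𝓛 {v | p v})
    (hq : A.Definable 𝓛 {v | q v}) : A.Definable 𝓛 {v | p v ∧ q v} :=
  hp.inter hq

lemma Definable.or {p q : (α → M) → Prop} (hp : A.Definable 𝓛 {v | p v})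
    (hq : A.Definable 𝓛 {v | q v}) : A.Definable 𝓛 {v | p v ∨ q v} :=
  hp.union hq

lemma Definable.not {p : (α → M) → Prop} (hp : A.Definable 𝓛 {v | p v}) :
    A.Definable 𝓛 {v | ¬ p v} :=
  hp.compl

lemma Definable.forall_finite {ι : Type*} [Finite ι] {p : ι → (α → M) → Prop}
    (hp : ∀ i, A.Definable 𝓛 {v | p i v}) : A.Definable 𝓛 {v | ∀ i, p i v} := by
  convert definable_iInter_of_finite hp using 1
  ext v
  simp

lemma Definable.exists_one {p : (α → M) → M → Prop}
    (hp : A.Definable 𝓛 {w : α ⊕ Unit → M | p (fun i => w (Sum.inl i)) (w (Sum.inr ()))}) :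
    A.Definable 𝓛 {v | ∃ x, p v x} := by
  convert hp.exists_of_finite using 1
  ext v
  constructor
  · rintro ⟨x, hx⟩
    exact ⟨fun _ => x, hx⟩
  · rintro ⟨u, hu⟩
    exact ⟨u (), hu⟩

lemma Definable.forall_one {p : (α → M) → M → Prop}
    (hp : A.Definable 𝓛 {w : α ⊕ Unit → M | p (fun i => w (Sum.inl i)) (w (Sum.inr ()))}) :
    A.Definable 𝓛 {v | ∀ x, p v x} := by
  convert (Definable.exists_one (p := fun v x => ¬ p v x) hp.not).not using 1
  ext v
  simp

lemma TermDefinable.var (i : α) : A.TermDefinable 𝓛 fun v : α → M => v i :=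
  ⟨Term.var i, rfl⟩

lemma TermDefinable.const_of_mem {a : M} (ha : a ∈ A) :
    A.TermDefinable 𝓛 fun _ : α → M => a :=
  ⟨(𝓛.con (⟨a, ha⟩ : A)).term, by ext v; simp⟩

lemma TermDefinable.funMap {n : ℕ} (F : 𝓛.Functions n) {g : Fin n → (α → M) → M}
    (hg : ∀ i, A.TermDefinable 𝓛 (g i)) :
    A.TermDefinable 𝓛 fun v => Structure.funMap F fun i => g i v := by
  choose t ht using hg
  refine ⟨Term.func (Sum.inl F : 𝓛[[A]].Functions n) t, ?_⟩
  ext v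
  simp only [ht]
  rfl

lemma TermDefinable.eq {g h : (α → M) → M} (hg : A.TermDefinable 𝓛 g)
    (hh : A.TermDefinable 𝓛 h) : A.Definable 𝓛 {v | g v = h v} := by
  obtain ⟨s, rfl⟩ := hg
  obtain ⟨t, rfl⟩ := hh
  exact ⟨s.equal t, by ext v; simp⟩

lemma TermDefinable.relMap {n : ℕ} (R : 𝓛.Relations n) {g : Fin n → (α → M) → M}
    (hg : ∀ i, A.TermDefinable 𝓛 (g i)) :
    A.Definable 𝓛 {v | Structure.RelMap R fun i => g i v} := by
  choose t ht using hg
  refine ⟨Relations.formula (Sum.inl R : 𝓛[[A]].Relations n) t, ?_⟩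
  ext v
  simp only [ht, mem_ofPred_eq]
  exact (Formula.realize_rel (L := 𝓛[[A]]) (M := M) (R := Sum.inl R)).symm

end Set

/-! ### Interpretations and stability -/

section Interpretation

open FirstOrder.Language

variable (𝓛 : Language) {𝓛' : Language} {M N κ : Type*} [𝓛.Structure M] [𝓛'.Structure N]

/-- A set of tuples of `N` is pullback definable along `f : N → M ^ κ` when it is the preimage of a
set of tuples of `M` that is definable with parameters. -/
def PullbackDefinable (f : N → κ → M) {α : Type*} (S : Set (α → N)) : Prop :=
  ∃ R : Set (α × κ → M), (Set.univ : Set M).Definable 𝓛 R ∧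
    ∀ v, v ∈ S ↔ (fun p : α × κ => f (v p.1) p.2) ∈ R

variable (𝓛') in
/-- The map `f : N → M ^ κ` is an interpretation with parameters of the structure `N` in the
structure `M`, with equality interpreted by equality. -/
structure IsInterpretation (f : N → κ → M) : Prop where
  injective : Function.Injective f
  range_definable : (Set.univ : Set M).Definable 𝓛 (Set.range f)
  graph_definable {n : ℕ} (F : 𝓛'.Functions n) : PullbackDefinable 𝓛 f
    {v : Fin n ⊕ Unit → N | Structure.funMap F (fun i => v (Sum.inl i)) = v (Sum.inr ())}
  rel_definable {n : ℕ} (R : 𝓛'.Relations n) :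
    PullbackDefinable 𝓛 f {v : Fin n → N | Structure.RelMap R v}

variable {𝓛} {f : N → κ → M} {α β : Type*}

namespace PullbackDefinable

lemma congr {S T : Set (α → N)} (hS : PullbackDefinable 𝓛 f S) (h : ∀ v, v ∈ T ↔ v ∈ S) :
    PullbackDefinable 𝓛 f T := by
  rwa [Set.ext h]

lemma inter {S T : Set (α → N)} (hS : PullbackDefinable 𝓛 f S)
    (hT : PullbackDefinable 𝓛 f T) : PullbackDefinable 𝓛 f (S ∩ T) := by
  obtain ⟨R, hR, h⟩ := hS
  obtain ⟨R', hR', h'⟩ := hT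
  exact ⟨R ∩ R', hR.inter hR', fun v => and_congr (h v) (h' v)⟩

lemma compl {S : Set (α → N)} (hS : PullbackDefinable 𝓛 f S) : PullbackDefinable 𝓛 f Sᶜ := by
  obtain ⟨R, hR, h⟩ := hS
  exact ⟨Rᶜ, hR.compl, fun v => not_congr (h v)⟩

lemma iInter {ι : Type*} [Finite ι] {S : ι → Set (α → N)}
    (hS : ∀ i, PullbackDefinable 𝓛 f (S i)) : PullbackDefinable 𝓛 f (⋂ i, S i) := by
  choose R hR h using hS
  exact ⟨⋂ i, R i, Set.definable_iInter_of_finite hR, fun v => by simp [h]⟩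

lemma preimage_comp (g : α → β) {S : Set (α → N)} (hS : PullbackDefinable 𝓛 f S) :
    PullbackDefinable 𝓛 f {v : β → N | (fun i => v (g i)) ∈ S} := by
  obtain ⟨R, hR, h⟩ := hS
  exact ⟨_, hR.preimage_comp (Prod.map g id), fun v => h _⟩

end PullbackDefinable

namespace IsInterpretation

lemma eq [Finite κ] (hf : IsInterpretation 𝓛 𝓛' f) (i j : α) :
    PullbackDefinable 𝓛 f {v : α → N | v i = v j} := by
  refine ⟨{w | ∀ k, w (i, k) = w (j, k)}, .forall_finite fun k =>
    Set.TermDefinable.eq (.var _) (.var _), ?_⟩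
  exact fun v => ⟨fun (h : v i = v j) k => by simp [h], fun h => hf.injective (funext h)⟩

lemma exists_finite [Finite κ] [Finite β] (hf : IsInterpretation 𝓛 𝓛' f)
    {S : Set (α ⊕ β → N)} (hS : PullbackDefinable 𝓛 f S) :
    PullbackDefinable 𝓛 f {v : α → N | ∃ u : β → N, Sum.elim v u ∈ S} := by
  obtain ⟨R, hR, h⟩ := hS
  let r : (α ⊕ β) × κ → (α × κ) ⊕ (β × κ) := Equiv.sumProdDistrib α β κ
  have h₁ := hR.preimage_comp r
  -- A quantifier over `N` becomes a quantifier over tuples of `M` restricted to the definable range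
  -- of `f`.
  have h₂ : (Set.univ : Set M).Definable 𝓛
      {w : (α × κ) ⊕ (β × κ) → M | ∀ b : β, (fun k => w (Sum.inr (b, k))) ∈ Set.range f} :=
    .forall_finite fun b => hf.range_definable.preimage_comp fun k => Sum.inr (b, k)
  refine ⟨_, (h₁.inter h₂).exists_of_finite, fun v => ?_⟩
  have key (u : β → N) : (fun p : (α ⊕ β) × κ => f ((Sum.elim v u : α ⊕ β → N) p.1) p.2) =
      (Sum.elim (fun p : α × κ => f (v p.1) p.2) fun p : β × κ => f (u p.1) p.2) ∘ r := by
    ext ⟨_ | _, _⟩ <;> rfl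
  constructor
  · rintro ⟨u, hu⟩
    refine ⟨fun p => f (u p.1) p.2, ?_, fun b => ⟨u b, rfl⟩⟩
    have := (h _).1 hu
    rwa [key] at this
  · rintro ⟨w, hw, hb⟩
    choose u hu using hb
    refine ⟨u, (h _).2 ?_⟩
    rw [key]
    have : w = fun p : β × κ => f (u p.1) p.2 := by
      funext ⟨b, k⟩
      exact (congrFun (hu b) k).symm
    rw [this] at hw
    exact hw

/-- Function symbols are interpreted only through their graphs, so a compound term is handled by
quantifying over the values of its arguments. -/
lemma term [Finite κ] (hf : IsInterpretation 𝓛 𝓛' f) (t : 𝓛'.Term α) :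
    PullbackDefinable 𝓛 f
      {v : α ⊕ Unit → N | t.realize (fun i => v (Sum.inl i)) = v (Sum.inr ())} := by
  induction t with
  | var i => exact hf.eq _ _
  | @func n F ts ih =>
    have h₁ := PullbackDefinable.iInter fun i => (ih i).preimage_comp
      (Sum.elim (fun a => Sum.inl (Sum.inl a)) (fun _ => Sum.inr i) :
        α ⊕ Unit → (α ⊕ Unit) ⊕ Fin n)
    have h₂ := (hf.graph_definable F).preimage_comp
      (Sum.elim Sum.inr (fun _ => Sum.inl (Sum.inr ())) :
        Fin n ⊕ Unit → (α ⊕ Unit) ⊕ Fin n)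
    refine (hf.exists_finite (h₁.inter h₂)).congr fun v => ?_
    simp only [Set.mem_ofPred_eq, Set.mem_inter_iff, Set.mem_iInter, Sum.elim_inl, Sum.elim_inr,
      Term.realize_func]
    constructor
    · exact fun h => ⟨fun i => (ts i).realize fun a => v (Sum.inl a), fun i => rfl, h⟩
    · rintro ⟨u, hu, h⟩
      rwa [← funext hu] at h

lemma boundedFormula [Finite κ] [Finite α] (hf : IsInterpretation 𝓛 𝓛' f) {n : ℕ}
    (φ : 𝓛'.BoundedFormula α n) :
    PullbackDefinable 𝓛 f
      {v : α ⊕ Fin n → N | φ.Realize (fun i => v (Sum.inl i)) (fun i => v (Sum.inr i))} := by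
  induction φ with
  | falsum => exact ⟨∅, Set.definable_empty, fun v => by simp [BoundedFormula.Realize]⟩
  | @equal n s t =>
    have h₁ := (hf.term s).preimage_comp
      (Sum.map id id : (α ⊕ Fin n) ⊕ Unit → (α ⊕ Fin n) ⊕ Unit)
    refine (hf.exists_finite (h₁.inter (hf.term t))).congr fun v => ?_
    have hv : (Sum.elim (fun i => v (Sum.inl i)) fun i => v (Sum.inr i)) = v := by
      ext (i | i) <;> rfl
    simp only [Set.mem_ofPred_eq, Set.mem_inter_iff, BoundedFormula.Realize, hv, Sum.map_inl,
      Sum.map_inr, id, Sum.elim_inl, Sum.elim_inr]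
    exact ⟨fun h => ⟨fun _ => t.realize v, h, rfl⟩, fun ⟨u, hu, hu'⟩ => hu.trans hu'.symm⟩
  | @rel n l R ts =>
    have h₁ := PullbackDefinable.iInter fun i => (hf.term (ts i)).preimage_comp
      (Sum.map id (fun _ => i) : (α ⊕ Fin n) ⊕ Unit → (α ⊕ Fin n) ⊕ Fin l)
    have h₂ := (hf.rel_definable R).preimage_comp (Sum.inr : Fin l → (α ⊕ Fin n) ⊕ Fin l)
    refine (hf.exists_finite (h₁.inter h₂)).congr fun v => ?_
    have hv : (Sum.elim (fun i => v (Sum.inl i)) fun i => v (Sum.inr i)) = v := by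
      ext (i | i) <;> rfl
    simp only [Set.mem_ofPred_eq, Set.mem_inter_iff, Set.mem_iInter, BoundedFormula.Realize, hv,
      Sum.map_inl, Sum.map_inr, id, Sum.elim_inl, Sum.elim_inr]
    constructor
    · exact fun h => ⟨fun i => (ts i).realize v, fun i => rfl, h⟩
    · rintro ⟨u, hu, h⟩
      rwa [← funext hu] at h
  | imp φ ψ ihφ ihψ =>
    refine (ihφ.inter ihψ.compl).compl.congr fun v => ?_
    simp [BoundedFormula.Realize]
  | @all n φ ih =>
    -- `∀` is treated as `¬ ∃ ¬`. The bound variable, the last one of `Fin (n + 1)`, becomes the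
    -- extra `Unit` coordinate.
    have h := (ih.compl).preimage_comp
      (Sum.elim (fun a => Sum.inl (Sum.inl a))
        (Fin.lastCases (Sum.inr ()) fun i => Sum.inl (Sum.inr i)) :
        α ⊕ Fin (n + 1) → (α ⊕ Fin n) ⊕ Unit)
    refine (hf.exists_finite h).compl.congr fun v => ?_
    have key (u : Unit → N) : (fun i => (Sum.elim v u : (α ⊕ Fin n) ⊕ Unit → N)
        (Fin.lastCases (Sum.inr ()) (fun i => Sum.inl (Sum.inr i)) i)) =
        (Fin.snoc (fun i => v (Sum.inr i)) (u ()) : Fin (n + 1) → N) := by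
      funext i
      refine Fin.lastCases ?_ (fun i => ?_) i <;> simp
    simp only [Set.mem_ofPred_eq, Set.mem_compl_iff, BoundedFormula.Realize, Sum.elim_inl,
      Sum.elim_inr, key, not_exists, not_not]
    exact ⟨fun h u => h (u ()), fun h x => h fun _ => x⟩

lemma formula [Finite κ] [Finite α] (hf : IsInterpretation 𝓛 𝓛' f) (φ : 𝓛'.Formula α) :
    PullbackDefinable 𝓛 f {v : α → N | φ.Realize v} := by
  obtain ⟨R, hR, h⟩ := hf.boundedFormula φ
  refine ⟨_, hR.preimage_comp (Prod.map (Sum.elim id Fin.elim0 : α ⊕ Fin 0 → α) id), fun v => ?_⟩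
  refine Iff.trans ?_ (h (Sum.elim v Fin.elim0)) |>.trans ?_
  · simp only [Set.mem_ofPred_eq, Formula.Realize, Sum.elim_inl, Sum.elim_inr]
    rw [Subsingleton.elim (default : Fin 0 → N) _]
  · rw [Set.mem_preimage]
    refine iff_of_eq (congrArg (· ∈ R) ?_)
    ext ⟨i | i, k⟩
    · rfl
    · exact i.elim0

end IsInterpretation

end Interpretation

/-- Ladders are bounded for formulas with parameters and arbitrary finite index types. -/
lemma IsStable.definable {𝓛 : Language} {M : Type*} [S : 𝓛.Structure M] (hM : IsStable S)
    {α β : Type*} [Finite α] [Finite β]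
    {R : Set (α ⊕ β → M)} (hR : (Set.univ : Set M).Definable 𝓛 R) :
    ∃ n : ℕ, ¬ ∃ (a : Fin n → α → M) (b : Fin n → β → M),
      ∀ i j : Fin n, Sum.elim (a i) (b j) ∈ R ↔ i ≤ j := by
  obtain ⟨A, -, hA⟩ := Set.definable_iff_finitely_definable.1 hR
  obtain ⟨φ, rfl⟩ := Set.definable_iff_exists_formula_sum.1 hA
  obtain ⟨l, ⟨e⟩⟩ := Finite.exists_equiv_fin α
  obtain ⟨m, ⟨e'⟩⟩ := Finite.exists_equiv_fin ((A : Set M) ⊕ β)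
  -- The finitely many parameters are appended to the tuples `b j`, where they stay constant along
  -- the ladder.
  let g : (A : Set M) ⊕ (α ⊕ β) → Fin l ⊕ Fin m :=
    Sum.elim (fun x => Sum.inr (e' (Sum.inl x))) (Sum.map e fun y => e' (Sum.inr y))
  obtain ⟨n, hn⟩ := hM l m (φ.relabel g)
  refine ⟨n, fun ⟨a, b, hab⟩ => hn ⟨fun i x => a i (e.symm x),
    fun j y => Sum.elim (fun x : (A : Set M) => (x : M)) (b j) (e'.symm y), fun i j => ?_⟩⟩
  rw [← hab i j, Language.Formula.realize_relabel, Set.mem_ofPred_eq]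
  refine iff_of_eq (congrArg φ.Realize ?_)
  funext x
  rcases x with x | x | x <;> simp [g]

/-- A structure interpreted in a stable structure is stable. -/
theorem IsInterpretation.isStable {𝓛 𝓛' : Language} {M N κ : Type*} [SM : 𝓛.Structure M]
    [SN : 𝓛'.Structure N] [Finite κ] {f : N → κ → M}
    (hf : IsInterpretation 𝓛 𝓛' f) (hM : IsStable SM) : IsStable SN := by
  intro l m φ
  obtain ⟨R, hR, h⟩ := hf.formula φ
  -- A ladder in `N` is carried by `f` to a ladder of the same length in `M`, with each variable
  -- replaced by a `κ`-tuple.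
  obtain ⟨n, hn⟩ := hM.definable
    (hR.preimage_comp (Equiv.sumProdDistrib (Fin l) (Fin m) κ))
  refine ⟨n, fun ⟨a, b, hab⟩ => hn ⟨fun i p => f (a i p.1) p.2, fun j p => f (b j p.1) p.2,
    fun i j => ?_⟩⟩
  rw [← hab i j]
  refine Iff.trans ?_ (h _).symm
  rw [Set.mem_preimage]
  refine iff_of_eq (congrArg (· ∈ R) ?_)
  ext ⟨_ | _, _⟩ <;> rfl

/-! ### Matrix computations in `SL₂` -/

section Matrices

variable {F : Type*} [Field F]

lemma SLTwo.ext_entries {g h : SLTwo F} (h₀₀ : g 0 0 = h 0 0) (h₀₁ : g 0 1 = h 0 1)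
    (h₁₀ : g 1 0 = h 1 0) (h₁₁ : g 1 1 = h 1 1) : g = h := by
  refine Matrix.SpecialLinearGroup.ext _ _ fun i j => ?_
  fin_cases i <;> fin_cases j <;> assumption

lemma SLTwo.mul_apply (g h : SLTwo F) (i j : Fin 2) :
    (g * h) i j = g i 0 * h 0 j + g i 1 * h 1 j := by
  rw [Matrix.SpecialLinearGroup.coe_mul, Matrix.mul_apply, Fin.sum_univ_two]

lemma SLTwo.det_eq (g : SLTwo F) : g 0 0 * g 1 1 - g 0 1 * g 1 0 = 1 := by
  rw [← Matrix.det_fin_two, g.det_coe]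

@[simp] lemma upperUni_zero_zero (t : F) : upperUni t 0 0 = 1 := rfl
@[simp] lemma upperUni_zero_one (t : F) : upperUni t 0 1 = t := rfl
@[simp] lemma upperUni_one_zero (t : F) : upperUni t 1 0 = 0 := rfl
@[simp] lemma upperUni_one_one (t : F) : upperUni t 1 1 = 1 := rfl
@[simp] lemma lowerUni_zero_zero (t : F) : lowerUni t 0 0 = 1 := rfl
@[simp] lemma lowerUni_zero_one (t : F) : lowerUni t 0 1 = 0 := rfl
@[simp] lemma lowerUni_one_zero (t : F) : lowerUni t 1 0 = t := rfl
@[simp] lemma lowerUni_one_one (t : F) : lowerUni t 1 1 = 1 := rfl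
@[simp] lemma diagHom_zero_zero (u : Fˣ) : diagHom F u 0 0 = u := rfl
@[simp] lemma diagHom_zero_one (u : Fˣ) : diagHom F u 0 1 = 0 := rfl
@[simp] lemma diagHom_one_zero (u : Fˣ) : diagHom F u 1 0 = 0 := rfl
@[simp] lemma diagHom_one_one (u : Fˣ) : diagHom F u 1 1 = (u : F)⁻¹ := by
  rw [← Units.val_inv_eq_inv_val]; rfl

lemma upperUni_injective : Function.Injective (upperUni : F → SLTwo F) := fun s t h => by
  simpa using congrArg (fun g : SLTwo F => g 0 1) h

lemma diagHom_injective : Function.Injective (diagHom F) := fun s t h => Units.ext <| by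
  simpa using congrArg (fun g : SLTwo F => g 0 0) h

lemma upperUni_add (s t : F) : upperUni (s + t) = upperUni s * upperUni t := by
  apply SLTwo.ext_entries <;> simp [SLTwo.mul_apply, add_comm]

lemma upperUni_zero : upperUni (0 : F) = 1 := by
  apply SLTwo.ext_entries <;> simp

lemma lowerUni_zero : lowerUni (0 : F) = 1 := by
  apply SLTwo.ext_entries <;> simp

lemma lowerUni_add (s t : F) : lowerUni (s + t) = lowerUni s * lowerUni t := by
  apply SLTwo.ext_entries <;> simp [SLTwo.mul_apply]

lemma upperUni_neg (t : F) : upperUni (-t) = (upperUni t)⁻¹ := by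
  rw [eq_inv_iff_mul_eq_one, ← upperUni_add, neg_add_cancel, upperUni_zero]

lemma lowerUni_neg (t : F) : lowerUni (-t) = (lowerUni t)⁻¹ := by
  rw [eq_inv_iff_mul_eq_one, ← lowerUni_add, neg_add_cancel, lowerUni_zero]

lemma diagHom_conj_upperUni (u : Fˣ) (t : F) :
    diagHom F u * upperUni t * (diagHom F u)⁻¹ = upperUni ((u : F) ^ 2 * t) := by
  rw [mul_inv_eq_iff_eq_mul]
  have hu : (u : F) ≠ 0 := u.ne_zero
  apply SLTwo.ext_entries <;> simp [SLTwo.mul_apply]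
  field_simp

lemma upperUni_mul_diagHom_iff {x : F} {u : Fˣ} :
    upperUni x * diagHom F u = diagHom F u * upperUni 1 ↔ (u : F) ^ 2 = x := by
  rw [← eq_mul_inv_iff_mul_eq, diagHom_conj_upperUni, mul_one, upperUni_injective.eq_iff, eq_comm]

/-- The monomial matrix `a(1) b(-1) a(1)`. -/
def weyl (F : Type*) [Field F] : SLTwo F := upperUni 1 * lowerUni (-1) * upperUni 1

@[simp] lemma weyl_zero_zero : weyl F 0 0 = 0 := by simp [weyl, SLTwo.mul_apply]
@[simp] lemma weyl_zero_one : weyl F 0 1 = 1 := by simp [weyl, SLTwo.mul_apply]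
@[simp] lemma weyl_one_zero : weyl F 1 0 = -1 := by simp [weyl, SLTwo.mul_apply]
@[simp] lemma weyl_one_one : weyl F 1 1 = 0 := by simp [weyl, SLTwo.mul_apply]

lemma exists_eq_diagHom_of_entries {g : SLTwo F} (hb : g 0 1 = 0) (hc : g 1 0 = 0) :
    ∃ u : Fˣ, g = diagHom F u := by
  have hdet := g.det_eq
  rw [hb, hc, mul_zero, sub_zero] at hdet
  have ha : g 0 0 ≠ 0 := left_ne_zero_of_mul_eq_one hdet
  refine ⟨Units.mk0 _ ha, SLTwo.ext_entries (by simp) (by simp [hb]) (by simp [hc]) ?_⟩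
  simpa using eq_inv_of_mul_eq_one_right hdet

/-- Zero, or an eigenvalue of an element of `T`. -/
def IsTorusEntry (T : Subgroup (SLTwo F)) (x : F) : Prop :=
  x = 0 ∨ ∃ u : Fˣ, diagHom F u ∈ T ∧ (u : F) = x

lemma IsTorusEntry.mul {T : Subgroup (SLTwo F)} {x y : F} (hx : IsTorusEntry T x)
    (hy : IsTorusEntry T y) :
    IsTorusEntry T (x * y) := by
  rcases hx with rfl | ⟨u, hu, rfl⟩
  · exact Or.inl (zero_mul _)
  rcases hy with rfl | ⟨v, hv, rfl⟩
  · exact Or.inl (mul_zero _)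
  · exact Or.inr ⟨u * v, by rw [map_mul]; exact mul_mem hu hv, Units.val_mul u v⟩

lemma IsTorusEntry.inv {T : Subgroup (SLTwo F)} {x : F} (hx : IsTorusEntry T x) :
    IsTorusEntry T x⁻¹ := by
  rcases hx with rfl | ⟨u, hu, rfl⟩
  · exact Or.inl inv_zero
  · exact Or.inr ⟨u⁻¹, by rw [map_inv]; exact inv_mem hu, Units.val_inv_eq_inv_val u⟩

/-! ### Centralizers and Weyl element identities in characteristic 2 -/

variable [CharP F 2]

lemma CharTwo.eq_of_sq_eq_sq {x y : F} (h : x ^ 2 = y ^ 2) : x = y := CharTwo.sq_injective h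

lemma commute_upperUni_one_iff {g : SLTwo F} :
    g * upperUni 1 = upperUni 1 * g ↔ g = upperUni (g 0 1) := by
  constructor
  · intro h
    have h₀₀ := congrArg (fun x : SLTwo F => x 0 0) h
    have h₀₁ := congrArg (fun x : SLTwo F => x 0 1) h
    simp only [SLTwo.mul_apply, upperUni_zero_zero, upperUni_one_zero, upperUni_zero_one,
      upperUni_one_one, mul_one, one_mul, mul_zero, add_zero] at h₀₀ h₀₁
    have hc : g 1 0 = 0 := by simpa using h₀₀.symm
    have hd : g 0 0 = g 1 1 := by linear_combination h₀₁
    have hdet := g.det_eq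
    -- The determinant is now the square of the diagonal entry, and 1 has no square root but 1 in
    -- characteristic 2.
    have ha : g 1 1 = 1 := by
      apply CharTwo.eq_of_sq_eq_sq
      rw [hc, hd] at hdet
      linear_combination hdet
    exact SLTwo.ext_entries (by simp [hd, ha]) (by simp) (by simp [hc]) (by simp [ha])
  · intro h
    rw [h, ← upperUni_add, ← upperUni_add, add_comm]

lemma commute_diagHom_iff {s : Fˣ} (hs : s ≠ 1) {g : SLTwo F} :
    g * diagHom F s = diagHom F s * g ↔ ∃ u : Fˣ, g = diagHom F u := by
  constructor
  · intro h
    -- Commuting with `Diag(s, s⁻¹)` says that `s² - 1` annihilates both off-diagonal entries.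
    have hs₂ : (s : F) ^ 2 - 1 ≠ 0 := fun h => hs (Units.ext
      (CharTwo.eq_of_sq_eq_sq (by rw [Units.val_one]; linear_combination h)))
    have hs₀ : (s : F) ≠ 0 := s.ne_zero
    have h₀₁ := congrArg (fun x : SLTwo F => x 0 1) h
    have h₁₀ := congrArg (fun x : SLTwo F => x 1 0) h
    simp only [SLTwo.mul_apply, diagHom_zero_zero, diagHom_one_zero, diagHom_zero_one,
      diagHom_one_one, mul_zero, zero_mul, zero_add, add_zero] at h₀₁ h₁₀
    field_simp at h₀₁ h₁₀
    refine exists_eq_diagHom_of_entries ((mul_eq_zero_iff_right hs₂).1 ?_)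
      ((mul_eq_zero_iff_right hs₂).1 ?_)
    · linear_combination -h₀₁
    · linear_combination h₁₀
  · rintro ⟨u, rfl⟩
    rw [← map_mul, ← map_mul, mul_comm]

lemma upperUni_mul_lowerUni_mul_upperUni (u : Fˣ) :
    upperUni (u : F) * lowerUni (u : F)⁻¹ * upperUni (u : F) * weyl F = diagHom F u := by
  have hu : (u : F) ≠ 0 := u.ne_zero
  apply SLTwo.ext_entries <;>
    simp [SLTwo.mul_apply, hu, CharTwo.neg_eq, CharTwo.add_self_eq_zero]

lemma weyl_mul_upperUni_mul_weyl (t : F) : weyl F * upperUni t * weyl F = lowerUni t := by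
  apply SLTwo.ext_entries <;>
    simp [SLTwo.mul_apply, CharTwo.neg_eq]

end Matrices

/-! ### The group `T · SL₂(L)` in terms of matrix entries -/

namespace Timmesfeld

variable {K : Type*} [Field K] [CharP K 2] (D : Timmesfeld K) {T : Subgroup (SLTwo K)}

lemma inv_mem_L {x : K} (hx : x ∈ D.L) : x⁻¹ ∈ D.L := by
  by_cases h : x = 0
  · simp [h]
  · have := D.sq_mul_mem x⁻¹ hx
    rwa [pow_two, mul_assoc, inv_mul_cancel₀ h, mul_one] at this

/-- Products and quotients differ by a square, and `L` is a vector space over `K²`. This allows the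
entry conditions to be stated with products alone. -/
lemma div_mem_of_mul_mem {x c : K} (hc : c ≠ 0) (h : x * c ∈ D.L) : x / c ∈ D.L := by
  have e : x / c = c⁻¹ ^ 2 * (x * c) := by field_simp
  rw [e]
  exact D.sq_mul_mem _ h

lemma upperUni_mem_SL2 {t : K} (ht : t ∈ D.L) : upperUni t ∈ D.SL2 :=
  Subgroup.subset_closure (Or.inl ⟨t, ht, rfl⟩)

lemma lowerUni_mem_SL2 {t : K} (ht : t ∈ D.L) : lowerUni t ∈ D.SL2 :=
  Subgroup.subset_closure (Or.inr ⟨t, ht, rfl⟩)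

lemma weyl_mem_SL2 : weyl K ∈ D.SL2 :=
  mul_mem (mul_mem (D.upperUni_mem_SL2 D.one_mem)
    (D.lowerUni_mem_SL2 (D.L.neg_mem D.one_mem))) (D.upperUni_mem_SL2 D.one_mem)

lemma torus_le_SL2 : D.torus ≤ D.SL2 := by
  rw [torus, Subgroup.map_le_iff_le_comap, unitsGen, Subgroup.closure_le]
  intro u hu
  rw [SetLike.mem_coe, Subgroup.mem_comap, ← upperUni_mul_lowerUni_mul_upperUni]
  exact mul_mem (mul_mem (mul_mem (D.upperUni_mem_SL2 hu) (D.lowerUni_mem_SL2 (D.inv_mem_L hu)))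
    (D.upperUni_mem_SL2 hu)) D.weyl_mem_SL2

lemma group_torus : D.group D.torus = D.SL2 := sup_eq_right.2 D.torus_le_SL2

lemma torus_le_fullTorus : D.torus ≤ fullTorus K := by
  rintro _ ⟨u, -, rfl⟩
  exact ⟨u, rfl⟩

lemma diagHom_mem {u : Kˣ} (hT : D.torus ≤ T) (hu : (u : K) ∈ D.L) : diagHom K u ∈ T :=
  hT ⟨u, Subgroup.subset_closure hu, rfl⟩

lemma isTorusEntry_of_mem (hT : D.torus ≤ T) {x : K} (hx : x ∈ D.L) : IsTorusEntry T x := by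
  by_cases h : x = 0
  · exact Or.inl h
  · exact Or.inr ⟨Units.mk0 x h, D.diagHom_mem hT hx, rfl⟩

/-- The conditions on the entries that characterize the matrices in `T · SL₂(L)`. -/
structure EntryCond (T : Subgroup (SLTwo K)) (a b c d : K) : Prop where
  det : a * d + b * c = 1
  fst : IsTorusEntry T a
  snd : IsTorusEntry T b
  trd : IsTorusEntry T c
  fth : IsTorusEntry T d
  row : a * b ∈ D.L
  row' : c * d ∈ D.L
  col : a * c ∈ D.L
  col' : b * d ∈ D.L

namespace EntryCond

variable {D} {a b c d : K}

lemma swap (h : D.EntryCond T a b c d) : D.EntryCond T c d a b where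
  det := by linear_combination h.det
  fst := h.trd
  snd := h.fth
  trd := h.fst
  fth := h.snd
  row := h.row'
  row' := h.row
  col := by rw [mul_comm]; exact h.col
  col' := by rw [mul_comm]; exact h.col'

/-- Left multiplication by `a(t)`. The cross terms in each product are either a square times an
element of `L`, or combine by the determinant condition to `t` itself. -/
lemma add_row (hT : D.torus ≤ T) (h : D.EntryCond T a b c d) {t : K} (ht : t ∈ D.L) :
    D.EntryCond T (a + t * c) (b + t * d) c d := by
  -- For `y ≠ 0` the new entry is an element of `L` divided by `y`. Nonzero elements of `L` are
  -- eigenvalues of elements of `T`, because `T` contains `T(L)`.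
  have entry {x y : K} (hx : IsTorusEntry T x) (hy : IsTorusEntry T y)
      (hxy : (x + t * y) * y ∈ D.L) : IsTorusEntry T (x + t * y) := by
    by_cases h0 : y = 0
    · simpa [h0] using hx
    · rw [← mul_div_cancel_right₀ (x + t * y) h0, div_eq_mul_inv]
      exact (D.isTorusEntry_of_mem hT hxy).mul hy.inv
  have col : (a + t * c) * c ∈ D.L := by
    have e : (a + t * c) * c = a * c + c ^ 2 * t := by ring
    rw [e]
    exact D.L.add_mem h.col (D.sq_mul_mem _ ht)
  have col' : (b + t * d) * d ∈ D.L := by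
    have e : (b + t * d) * d = b * d + d ^ 2 * t := by ring
    rw [e]
    exact D.L.add_mem h.col' (D.sq_mul_mem _ ht)
  refine ⟨?_, entry h.fst h.trd col, entry h.snd h.fth col', h.trd, h.fth, ?_, h.row', col, col'⟩
  · linear_combination h.det + t * c * d * CharTwo.two_eq_zero (R := K)
  · have e : (a + t * c) * (b + t * d) = a * b + t + t ^ 2 * (c * d) := by
      linear_combination t * h.det
    rw [e]
    exact D.L.add_mem (D.L.add_mem h.row ht) (D.sq_mul_mem _ h.row')

lemma scale (h : D.EntryCond T a b c d) {u : Kˣ} (hu : diagHom K u ∈ T) :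
    D.EntryCond T (u * a) (u * b) ((u : K)⁻¹ * c) ((u : K)⁻¹ * d) := by
  have hu₀ : (u : K) ≠ 0 := u.ne_zero
  have hu' : IsTorusEntry T (u : K) := Or.inr ⟨u, hu, rfl⟩
  refine ⟨?_, hu'.mul h.fst, hu'.mul h.snd, hu'.inv.mul h.trd, hu'.inv.mul h.fth, ?_, ?_, ?_, ?_⟩
  · have := h.det
    field_simp
    exact this
  · convert D.sq_mul_mem (u : K) h.row using 1
    ring
  · convert D.sq_mul_mem (u : K)⁻¹ h.row' using 1
    ring
  · convert h.col using 1
    field_simp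
  · convert h.col' using 1
    field_simp

end EntryCond

/-- The entry conditions hold for the identity and survive left multiplication by generators and by
`T`. Conversely, they place each factor of the Bruhat decomposition in `T` or in `SL₂(L)`. This is
what makes the group definable in a field with predicates for `L` and `T̄`. -/
theorem mem_group_iff (hT : D.torus ≤ T) (hT' : T ≤ fullTorus K) {g : SLTwo K} :
    g ∈ D.group T ↔ D.EntryCond T (g 0 0) (g 0 1) (g 1 0) (g 1 1) := by
  constructor
  · intro hg
    have hg' : g ∈ (D.group T : Set (SLTwo K)) := hg
    rw [D.coe_group hT'] at hg'
    obtain ⟨h, hh, s, hs, rfl⟩ := hg'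
    have upper (t : K) (ht : t ∈ D.L) (y : SLTwo K)
        (hy : D.EntryCond T (y 0 0) (y 0 1) (y 1 0) (y 1 1)) :
        D.EntryCond T ((upperUni t * y) 0 0) ((upperUni t * y) 0 1) ((upperUni t * y) 1 0)
          ((upperUni t * y) 1 1) := by
      simpa [SLTwo.mul_apply] using hy.add_row hT ht
    have lower (t : K) (ht : t ∈ D.L) (y : SLTwo K)
        (hy : D.EntryCond T (y 0 0) (y 0 1) (y 1 0) (y 1 1)) :
        D.EntryCond T ((lowerUni t * y) 0 0) ((lowerUni t * y) 0 1) ((lowerUni t * y) 1 0)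
          ((lowerUni t * y) 1 1) := by
      simpa [SLTwo.mul_apply, add_comm] using (hy.swap.add_row hT ht).swap
    clear hg
    have hs' : D.EntryCond T (s 0 0) (s 0 1) (s 1 0) (s 1 1) := by
      induction hs using Subgroup.closure_induction_left with
      | one =>
        refine ⟨?_, ?_, ?_, ?_, ?_, ?_, ?_, ?_, ?_⟩ <;>
          simp [D.L.zero_mem, IsTorusEntry]
      | mul_left x hx y hy ih =>
        rcases hx with ⟨t, ht, rfl⟩ | ⟨t, ht, rfl⟩
        · exact upper t ht y ih
        · exact lower t ht y ih
      | inv_mul_cancel x hx y hy ih =>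
        rcases hx with ⟨t, ht, rfl⟩ | ⟨t, ht, rfl⟩
        · rw [← upperUni_neg]
          exact upper _ (D.L.neg_mem ht) y ih
        · rw [← lowerUni_neg]
          exact lower _ (D.L.neg_mem ht) y ih
    obtain ⟨u, rfl⟩ := hT' hh
    simpa [SLTwo.mul_apply] using hs'.scale hh
  · intro h
    have hS {x : SLTwo K} (hx : x ∈ D.SL2) : x ∈ D.group T := le_sup_right (a := T) hx
    have hT'' {x : SLTwo K} (hx : x ∈ T) : x ∈ D.group T := le_sup_left (b := D.SL2) hx
    have hdet := h.det
    by_cases hc : g 1 0 = 0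
    · rw [hc, mul_zero, add_zero] at hdet
      have ha : g 0 0 ≠ 0 := left_ne_zero_of_mul_eq_one hdet
      obtain ⟨u, hu, hua⟩ := h.fst.resolve_left ha
      -- The Borel case of the Bruhat decomposition.
      have e : g = diagHom K u * upperUni (g 0 1 / g 0 0) := by
        apply SLTwo.ext_entries <;> simp [SLTwo.mul_apply, hua, hc]
        · field_simp
        · exact eq_inv_of_mul_eq_one_right hdet
      rw [e]
      exact mul_mem (hT'' hu) (hS (D.upperUni_mem_SL2
        (D.div_mem_of_mul_mem ha (by rw [mul_comm]; exact h.row))))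
    · obtain ⟨u, hu, huc⟩ := h.trd.resolve_left hc
      -- The big cell: the lower left entry determines the torus part, and its ratios with the
      -- diagonal entries give the unipotent parts.
      have e : g = upperUni (g 0 0 / g 1 0) * (diagHom K u)⁻¹ * weyl K *
          upperUni (g 1 1 / g 1 0) := by
        rw [← map_inv]
        apply SLTwo.ext_entries <;> simp [-map_inv, SLTwo.mul_apply, huc, CharTwo.neg_eq]
        all_goals field_simp
        linear_combination hdet - g 0 0 * g 1 1 * CharTwo.two_eq_zero (R := K)

      rw [e]
      exact mul_mem (mul_mem (mul_mem
        (hS (D.upperUni_mem_SL2 (D.div_mem_of_mul_mem hc h.col)))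
        (inv_mem (hT'' hu))) (hS D.weyl_mem_SL2))
        (hS (D.upperUni_mem_SL2 (D.div_mem_of_mul_mem hc (by rw [mul_comm]; exact h.row'))))

/-! ### Unipotent and diagonal elements of the group, and the set `T̄` -/

lemma upperUni_mem_group_iff (hT : D.torus ≤ T) (hT' : T ≤ fullTorus K) {t : K} :
    upperUni t ∈ D.group T ↔ t ∈ D.L := by
  refine ⟨fun h => ?_, fun h => le_sup_right (a := T) (D.upperUni_mem_SL2 h)⟩
  simpa using ((D.mem_group_iff hT hT').1 h).row

lemma diagHom_mem_group_iff (hT : D.torus ≤ T) (hT' : T ≤ fullTorus K) {u : Kˣ} :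
    diagHom K u ∈ D.group T ↔ diagHom K u ∈ T := by
  refine ⟨fun h => ?_, fun h => le_sup_left (b := D.SL2) h⟩
  obtain h0 | ⟨v, hv, h⟩ := ((D.mem_group_iff hT hT').1 h).fst
  · exact absurd h0 u.ne_zero
  · rwa [Units.ext (h.trans (diagHom_zero_zero u))] at hv

lemma SL2_inf_fullTorus : D.SL2 ⊓ fullTorus K = D.torus := by
  refine le_antisymm ?_ (le_inf D.torus_le_SL2 D.torus_le_fullTorus)
  rintro _ ⟨hg, u, rfl⟩
  rw [← D.diagHom_mem_group_iff le_rfl D.torus_le_fullTorus, D.group_torus]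
  exact hg

lemma mem_Tbar_iff (hT' : T ≤ fullTorus K) {x : K} :
    x ∈ D.Tbar T ↔ ∃ u : Kˣ, diagHom K u ∈ T ∧ (u : K) ^ 2 = x := by
  constructor
  · rintro ⟨h, hh, H⟩
    obtain ⟨u, rfl⟩ := hT' hh
    -- The multiplier is detected at `t = 1`, which lies in `L`.
    have := H 1 D.one_mem
    rw [diagHom_conj_upperUni] at this
    exact ⟨u, hh, by simpa using upperUni_injective this⟩
  · rintro ⟨u, hu, rfl⟩
    exact ⟨_, hu, fun t _ => diagHom_conj_upperUni u t⟩

lemma sq_mem_Tbar_iff (hT' : T ≤ fullTorus K) {u : Kˣ} :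
    (u : K) ^ 2 ∈ D.Tbar T ↔ diagHom K u ∈ T := by
  rw [D.mem_Tbar_iff hT']
  refine ⟨fun ⟨v, hv, h⟩ => ?_, fun h => ⟨u, h, rfl⟩⟩
  rwa [Units.ext (CharTwo.eq_of_sq_eq_sq h)] at hv

lemma Tbar_subset (hT' : T ≤ fullTorus K) : D.Tbar T ⊆ D.L := by
  intro x hx
  obtain ⟨u, -, rfl⟩ := (D.mem_Tbar_iff hT').1 hx
  exact D.sq_mem _

lemma sq_mem_Tbar (hT : D.torus ≤ T) (hT' : T ≤ fullTorus K) {x : K} (hx : x ∈ D.L)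
    (h0 : x ≠ 0) : x ^ 2 ∈ D.Tbar T :=
  (D.sq_mem_Tbar_iff hT' (u := Units.mk0 x h0)).2 (D.diagHom_mem hT hx)

lemma Tbar_torus : D.Tbar D.torus = {a | ∃ u ∈ D.unitsGen, a = (u : K) ^ 2} := by
  ext x
  rw [D.mem_Tbar_iff D.torus_le_fullTorus]
  refine exists_congr fun u => and_congr ?_ eq_comm
  exact Subgroup.mem_map_iff_mem diagHom_injective

lemma isTorusEntry_iff (hT' : T ≤ fullTorus K) {x : K} :
    IsTorusEntry T x ↔ x = 0 ∨ x ^ 2 ∈ D.Tbar T := by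
  refine or_congr_right ?_
  rw [D.mem_Tbar_iff hT']
  exact exists_congr fun u => and_congr_right fun _ =>
    ⟨fun h => by rw [h], CharTwo.eq_of_sq_eq_sq⟩

/-! ### The field of square roots -/

lemma exists_ne_of_not_perfectField (hK : ¬ PerfectField K) : ∃ x : K, ∀ y, y ^ 2 ≠ x := by
  by_contra! h
  have : PerfectRing K 2 := PerfectRing.ofSurjective K 2 h
  exact hK (PerfectRing.toPerfectField K 2)

/-- Squares of elements of `K̃` lie in `K`. If `K̃` were perfect, the square of a fourth root of `x
∈ K` would be a square root of `x` in `K`. -/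
lemma not_perfectField_tilde (hK : ¬ PerfectField K) : ¬ PerfectField D.tilde := by
  intro _
  obtain ⟨x, hx⟩ := exists_ne_of_not_perfectField hK
  obtain ⟨y, hy⟩ := surjective_frobenius D.tilde 2 (D.incl x)
  obtain ⟨z, hz⟩ := surjective_frobenius D.tilde 2 y
  obtain ⟨a, -, ha⟩ := D.exists_incl_eq_sq z
  refine hx a (D.incl.injective ?_)
  rw [frobenius_def] at hy hz
  rw [map_pow, ha, hz, hy]

lemma map_incl_SL2 :
    D.SL2.map (Matrix.SpecialLinearGroup.map D.incl) = D.overTilde.SL2 := by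
  have hu (t : K) : Matrix.SpecialLinearGroup.map D.incl (upperUni t) = upperUni (D.incl t) := by
    apply SLTwo.ext_entries <;> simp
  have hl (t : K) : Matrix.SpecialLinearGroup.map D.incl (lowerUni t) = lowerUni (D.incl t) := by
    apply SLTwo.ext_entries <;> simp
  have hL : (D.overTilde.L : Set D.tilde) = D.incl '' D.L := rfl
  rw [SL2, SL2, MonoidHom.map_closure, Set.image_union, hL]
  simp only [Set.image_image, hu, hl]

/-- The squaring map from `K̃` to `L`. -/
noncomputable def sqMap (x : D.tilde) : D.L :=
  ⟨(D.exists_incl_eq_sq x).choose, by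
    simpa using (D.exists_incl_eq_sq x).choose_spec.1 1 D.one_mem⟩

lemma incl_sqMap (x : D.tilde) : D.incl (D.sqMap x) = x ^ 2 :=
  (D.exists_incl_eq_sq x).choose_spec.2

lemma sqMap_mem_stabilizer (x : D.tilde) : (D.sqMap x : K) ∈ D.stabilizer :=
  (D.exists_incl_eq_sq x).choose_spec.1

lemma sqMap_injective : Function.Injective D.sqMap := fun x y h =>
  CharTwo.eq_of_sq_eq_sq (by rw [← incl_sqMap, h, incl_sqMap])

lemma sqMap_eq_iff {x : D.tilde} {y : D.L} : D.sqMap x = y ↔ x ^ 2 = D.incl y := by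
  rw [← incl_sqMap, D.incl.injective.eq_iff, Subtype.ext_iff]

/-- Every element of `K₁` has a square root in the algebraic closure, and `K̃` contains it by
definition. -/
lemma exists_sqMap_eq_iff {y : D.L} : (∃ x, D.sqMap x = y) ↔ (y : K) ∈ D.stabilizer := by
  constructor
  · rintro ⟨x, rfl⟩
    exact D.sqMap_mem_stabilizer x
  · intro hy
    obtain ⟨x, hx⟩ := IsAlgClosed.exists_pow_nat_eq
      (algebraMap K (AlgebraicClosure K) y) two_pos
    refine ⟨⟨x, D.mem_tilde.2 ⟨y, hy, hx.symm⟩⟩, D.sqMap_eq_iff.2 (Subtype.ext hx)⟩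

end Timmesfeld

/-! ### Terms in the languages of groups, of fields with predicates, and of `(L, T̄, ·, σ)` -/

section Terms

open Set

variable {α : Type*}

section

variable {G : Type*} [Group G] {A : Set G} {g h : (α → G) → G}

attribute [local instance] groupStructure

lemma Set.TermDefinable.group_mul (hg : A.TermDefinable groupLang g)
    (hh : A.TermDefinable groupLang h) : A.TermDefinable groupLang fun v => g v * h v :=
  .funMap (𝓛 := groupLang) GroupFunc.mul (g := ![g, h]) (Fin.forall_fin_two.2 ⟨hg, hh⟩)

lemma Set.TermDefinable.group_inv (hg : A.TermDefinable groupLang g) :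
    A.TermDefinable groupLang fun v => (g v)⁻¹ :=
  .funMap (𝓛 := groupLang) GroupFunc.inv (g := fun _ => g) fun _ => hg

/-- Definability of the relation which expresses, in a group of matrices, that one unitriangular
matrix is obtained from another by squaring its entry. -/
lemma Set.definable_group_sq (e w c : G) (i j : α) : (univ : Set G).Definable groupLang
    {v : α → G | (v i = 1 ∧ v j = 1) ∨ ∃ y, y * e = e * y ∧
      v i * (w * y * w) * v i * w * c = c * (v i * (w * y * w) * v i * w) ∧
      v j * (v i * (w * y * w) * v i * w) = v i * (w * y * w) * v i * w * e} := by
  have const {β : Type _} (g : G) : (univ : Set G).TermDefinable groupLang fun _ : β → G => g :=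
    .const_of_mem (mem_univ g)
  have hh : (univ : Set G).TermDefinable groupLang fun v : α ⊕ Unit → G =>
      v (Sum.inl i) * (w * v (Sum.inr ()) * w) * v (Sum.inl i) * w :=
    .group_mul (.group_mul (.group_mul (.var _) (.group_mul (.group_mul (const w) (.var _))
      (const w))) (.var _)) (const w)
  have hy : (univ : Set G).TermDefinable groupLang fun v : α ⊕ Unit → G => v (Sum.inr ()) := .var _
  have hz : (univ : Set G).TermDefinable groupLang fun v : α ⊕ Unit → G => v (Sum.inl j) := .var _
  exact ((TermDefinable.eq (.var i) (const 1)).and (TermDefinable.eq (.var j) (const 1))).or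
    (Definable.exists_one
      (.and ((hy.group_mul (const e)).eq ((const e).group_mul hy))
        (.and ((hh.group_mul (const c)).eq ((const c).group_mul hh))
          ((hz.group_mul hh).eq (hh.group_mul (const e))))))

end

section

variable {F : Type*} [Field F] (P Q : Set F) {A : Set F} {g h : (α → F) → F}

lemma Set.TermDefinable.field_add : letI := fieldPairStructure F P Q
    A.TermDefinable fieldPairLang g → A.TermDefinable fieldPairLang h →
      A.TermDefinable fieldPairLang fun v => g v + h v :=
  letI := fieldPairStructure F P Q
  fun hg hh => .funMap (𝓛 := fieldPairLang) ringFunc.add (g := ![g, h])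
    (Fin.forall_fin_two.2 ⟨hg, hh⟩)

lemma Set.TermDefinable.field_mul : letI := fieldPairStructure F P Q
    A.TermDefinable fieldPairLang g → A.TermDefinable fieldPairLang h →
      A.TermDefinable fieldPairLang fun v => g v * h v :=
  letI := fieldPairStructure F P Q
  fun hg hh => .funMap (𝓛 := fieldPairLang) ringFunc.mul (g := ![g, h])
    (Fin.forall_fin_two.2 ⟨hg, hh⟩)

lemma Set.TermDefinable.mem_fst : letI := fieldPairStructure F P Q
    A.TermDefinable fieldPairLang g → A.Definable fieldPairLang {v | g v ∈ P} :=
  letI := fieldPairStructure F P Q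
  fun hg => TermDefinable.relMap (𝓛 := fieldPairLang) PredPair.fst (g := fun _ => g) fun _ => hg

lemma Set.TermDefinable.mem_snd : letI := fieldPairStructure F P Q
    A.TermDefinable fieldPairLang g → A.Definable fieldPairLang {v | g v ∈ Q} :=
  letI := fieldPairStructure F P Q
  fun hg => TermDefinable.relMap (𝓛 := fieldPairLang) PredPair.snd (g := fun _ => g) fun _ => hg

end

section

variable {K : Type*} [Field K] [CharP K 2] (D : Timmesfeld K) (T : Subgroup (SLTwo K))
  {A : Set D.L} {g h k : (α → D.L) → D.L}

/-- Squaring on `L`. -/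
def Timmesfeld.sq (x : D.L) : D.L := ⟨(x : K) ^ 2, D.sq_mem _⟩

lemma Set.TermDefinable.coord_zero : letI := D.coordStructure T
    A.TermDefinable coordLang fun _ : α → D.L => 0 :=
  letI := D.coordStructure T
  .funMap (𝓛 := coordLang) CoordFunc.zero (g := Fin.elim0) fun i => i.elim0

lemma Set.TermDefinable.coord_sq : letI := D.coordStructure T
    A.TermDefinable coordLang g → A.TermDefinable coordLang fun v => D.sq (g v) :=
  letI := D.coordStructure T
  fun hg => .funMap (𝓛 := coordLang) CoordFunc.sq (g := fun _ => g) fun _ => hg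

lemma Set.TermDefinable.coord_add : letI := D.coordStructure T
    A.TermDefinable coordLang g → A.TermDefinable coordLang h →
      A.TermDefinable coordLang fun v => g v + h v :=
  letI := D.coordStructure T
  fun hg hh => .funMap (𝓛 := coordLang) CoordFunc.add (g := ![g, h])
    (Fin.forall_fin_two.2 ⟨hg, hh⟩)

lemma Set.TermDefinable.mem_Tbar : letI := D.coordStructure T
    A.TermDefinable coordLang g → A.Definable coordLang {v | (g v : K) ∈ D.Tbar T} :=
  letI := D.coordStructure T
  fun hg => TermDefinable.relMap (𝓛 := coordLang) CoordRel.torus (g := fun _ => g) fun _ => hg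

/-- Multiplication is definable as far as it is defined on `L`. -/
lemma Set.TermDefinable.coord_mul_eq {T} (hT : D.torus ≤ T) (hT' : T ≤ fullTorus K) :
    letI := D.coordStructure T
    A.TermDefinable coordLang g → A.TermDefinable coordLang h → A.TermDefinable coordLang k →
      A.Definable coordLang {v | (g v : K) * h v = k v} := by
  intro hg hh hk
  let := D.coordStructure T
  -- Nonzero elements of `L` have squares in `T̄`, where multiplication is available. Injectivity of
  -- squaring recovers `xy = z` from `x²y² = z²`; zero factors are treated separately.
  have hmul : A.Definable coordLang {v | (D.sq (g v) : K) ∈ D.Tbar T ∧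
      (D.sq (h v) : K) ∈ D.Tbar T ∧ (D.sq (g v) : K) * D.sq (h v) = D.sq (k v)} :=
    TermDefinable.relMap (𝓛 := coordLang) CoordRel.mul
      (g := ![fun v => D.sq (g v), fun v => D.sq (h v), fun v => D.sq (k v)])
      (by simpa [Fin.forall_fin_succ] using ⟨.coord_sq D T hg, .coord_sq D T hh, .coord_sq D T hk⟩)
  have h0 := TermDefinable.coord_zero (α := α) (A := A) D T
  convert (((hg.eq h0).or (hh.eq h0)).and (hk.eq h0)).or hmul using 1
  ext v
  simp only [mem_ofPred_eq, ← Subtype.val_inj (b := (0 : D.L)),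
    ZeroMemClass.coe_zero]
  constructor
  · intro e
    by_cases hg0 : (g v : K) = 0
    · exact Or.inl ⟨Or.inl hg0, by rw [← e, hg0, zero_mul]⟩
    by_cases hh0 : (h v : K) = 0
    · exact Or.inl ⟨Or.inr hh0, by rw [← e, hh0, mul_zero]⟩
    refine Or.inr ⟨D.sq_mem_Tbar hT hT' (g v).2 hg0, D.sq_mem_Tbar hT hT' (h v).2 hh0, ?_⟩
    simp [Timmesfeld.sq, ← e, mul_pow]
  · rintro (⟨h | h, e⟩ | ⟨-, -, e⟩)
    · rw [h, e, zero_mul]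
    · rw [h, e, mul_zero]
    · exact CharTwo.eq_of_sq_eq_sq (by simpa [Timmesfeld.sq, mul_pow] using e)

/-- The condition `aL ≤ L` asks that for all `x ∈ L` some `z ∈ L` satisfies `ax = z`, so the partial
multiplication on `L` suffices. -/
lemma Timmesfeld.definable_stabilizer {T} (hT : D.torus ≤ T) (hT' : T ≤ fullTorus K) (i : α) :
    letI := D.coordStructure T
    A.Definable coordLang {v : α → D.L | (v i : K) ∈ D.stabilizer} := by
  let := D.coordStructure T
  have := Definable.forall_one (Definable.exists_one
    (p := fun (w : α ⊕ Unit → D.L) z => (w (Sum.inl i) : K) * w (Sum.inr ()) = z)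
    (TermDefinable.coord_mul_eq (A := A) D hT hT' (.var _) (.var _) (.var _)))
    (p := fun (v : α → D.L) x => ∃ z : D.L, (v i : K) * x = z)
  convert this using 1
  ext v
  constructor
  · exact fun h x => ⟨⟨_, h x x.2⟩, rfl⟩
  · intro h x hx
    obtain ⟨z, hz⟩ := h ⟨x, hx⟩
    exact hz ▸ z.2

end

end Terms

/-! ### The field `K̃` in the structure `(L, T̄, ·, σ)` -/

namespace Timmesfeld

open Set

variable {K : Type*} [Field K] [CharP K 2] (D : Timmesfeld K) {T : Subgroup (SLTwo K)}

lemma sqMap_zero : D.sqMap 0 = 0 := D.sqMap_eq_iff.2 (by simp)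

lemma sqMap_add (x y : D.tilde) : D.sqMap (x + y) = D.sqMap x + D.sqMap y :=
  D.sqMap_eq_iff.2 (by
    rw [AddSubgroup.coe_add, map_add, incl_sqMap, incl_sqMap, CharTwo.add_sq])

/-- The product is taken in `K`, since `L` need not be closed under multiplication. -/
lemma coe_sqMap_mul (x y : D.tilde) : (D.sqMap (x * y) : K) = D.sqMap x * D.sqMap y :=
  D.incl.injective (by rw [map_mul, incl_sqMap, incl_sqMap, incl_sqMap, mul_pow])

lemma sqMap_incl (x : D.L) : D.sqMap (D.incl x) = D.sq x :=
  D.sqMap_eq_iff.2 (map_pow D.incl _ _).symm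

lemma definesField_sqMap (hT : D.torus ≤ T) (hT' : T ≤ fullTorus K) :
    DefinesField (D.coordStructure T) D.sqMap := by
  let := D.coordStructure T
  have stab {n : ℕ} (i : Fin n) :
      (∅ : Set D.L).Definable coordLang {v : Fin n → D.L | (v i : K) ∈ D.stabilizer} :=
    D.definable_stabilizer hT hT' i
  refine ⟨D.sqMap_injective, ?_, ?_, ?_⟩
  · convert stab (0 : Fin 1) using 1
    ext v
    rw [mem_ofPred_eq, mem_ofPred_eq, ← exists_sqMap_eq_iff]
    simp only [eq_comm]
  · convert (stab (0 : Fin 3)).and ((stab 1).and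
      (TermDefinable.eq (.var 2) (.coord_add D T (.var 0) (.var 1)))) using 1
    ext v
    simp only [mem_ofPred_eq, ← exists_sqMap_eq_iff]
    constructor
    · rintro ⟨x, y, hx, hy, hz⟩
      exact ⟨⟨x, hx.symm⟩, ⟨y, hy.symm⟩, by rw [hx, hy, hz, sqMap_add]⟩
    · rintro ⟨⟨x, hx⟩, ⟨y, hy⟩, hz⟩
      exact ⟨x, y, hx.symm, hy.symm, by rw [hz, sqMap_add, hx, hy]⟩
  · convert (stab (0 : Fin 3)).and ((stab 1).and
      (TermDefinable.coord_mul_eq D hT hT' (.var 0) (.var 1) (.var 2))) using 1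
    ext v
    simp only [mem_ofPred_eq, ← exists_sqMap_eq_iff]
    constructor
    · rintro ⟨x, y, hx, hy, hz⟩
      exact ⟨⟨x, hx.symm⟩, ⟨y, hy.symm⟩, by rw [hx, hy, hz, coe_sqMap_mul]⟩
    · rintro ⟨⟨x, hx⟩, ⟨y, hy⟩, hz⟩
      exact ⟨x, y, hx.symm, hy.symm, Subtype.ext (by rw [← hz, coe_sqMap_mul, hx, hy])⟩

/-- The interpretation is squaring, `K̃ ≅ K₁ ⊆ L`. It turns the predicates `L` and `T̄` into `σ(L)`
and `σ(T̄)`. -/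
theorem isStable_field_of_coord (hT : D.torus ≤ T) (hT' : T ≤ fullTorus K)
    (h : IsStable (D.coordStructure T)) :
    IsStable (fieldPairStructure D.tilde (D.incl '' D.L) (D.incl '' D.Tbar T)) := by
  let := D.coordStructure T
  let := fieldPairStructure D.tilde (D.incl '' D.L) (D.incl '' D.Tbar T)
  have hf : IsInterpretation coordLang fieldPairLang
      (fun (x : D.tilde) (_ : Unit) => D.sqMap x) := by
    refine ⟨fun x y hxy => D.sqMap_injective (congrFun hxy ()), ?_, fun F => ?_, fun R => ?_⟩
    · convert D.definable_stabilizer (A := univ) hT hT' () using 1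
      ext w
      rw [mem_ofPred_eq, ← exists_sqMap_eq_iff]
      exact exists_congr fun x => ⟨fun h => congrFun h (), fun h => funext fun _ => h⟩
    · cases F with
      | zero =>
        refine ⟨_, TermDefinable.eq (.coord_zero D T) (.var (Sum.inr (), ())), fun v => ?_⟩
        change 0 = v (Sum.inr ()) ↔ 0 = D.sqMap (v (Sum.inr ()))
        rw [← sqMap_zero, D.sqMap_injective.eq_iff]
      | one =>
        refine ⟨_, TermDefinable.eq (.const_of_mem (mem_univ (D.sqMap 1)))
          (.var (Sum.inr (), ())), fun v => ?_⟩
        exact D.sqMap_injective.eq_iff.symm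
      | neg =>
        -- Negation is the identity in characteristic 2.
        refine ⟨_, TermDefinable.eq (.var (Sum.inl 0, ())) (.var (Sum.inr (), ())), fun v => ?_⟩
        change -v (Sum.inl 0) = v (Sum.inr ()) ↔ D.sqMap (v (Sum.inl 0)) = D.sqMap (v (Sum.inr ()))
        rw [D.sqMap_injective.eq_iff, CharTwo.neg_eq]
      | add =>
        refine ⟨_, TermDefinable.eq (.coord_add D T (.var (Sum.inl 0, ())) (.var (Sum.inl 1, ())))
          (.var (Sum.inr (), ())), fun v => ?_⟩
        change v (Sum.inl 0) + v (Sum.inl 1) = v (Sum.inr ()) ↔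
          D.sqMap (v (Sum.inl 0)) + D.sqMap (v (Sum.inl 1)) = D.sqMap (v (Sum.inr ()))
        rw [← sqMap_add, D.sqMap_injective.eq_iff]
      | mul =>
        refine ⟨_, TermDefinable.coord_mul_eq D hT hT' (.var (Sum.inl 0, ()))
          (.var (Sum.inl 1, ())) (.var (Sum.inr (), ())), fun v => ?_⟩
        change v (Sum.inl 0) * v (Sum.inl 1) = v (Sum.inr ()) ↔
          (D.sqMap (v (Sum.inl 0)) : K) * D.sqMap (v (Sum.inl 1)) = D.sqMap (v (Sum.inr ()))
        rw [← coe_sqMap_mul, Subtype.val_inj, D.sqMap_injective.eq_iff]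
    · cases R with
      | fst =>
        refine ⟨_, Definable.exists_one (p := fun w y => w (0, ()) = D.sq y)
          (TermDefinable.eq (.var _) (.coord_sq D T (.var _))), fun v => ?_⟩
        change v 0 ∈ D.incl '' D.L ↔ ∃ y, D.sqMap (v 0) = D.sq y
        constructor
        · rintro ⟨y, hy, h⟩
          exact ⟨⟨y, hy⟩, by rw [← h, ← sqMap_incl]⟩
        · rintro ⟨y, hy⟩
          rw [← sqMap_incl, D.sqMap_injective.eq_iff] at hy
          exact ⟨y, y.2, hy.symm⟩
      | snd =>
        refine ⟨_, Definable.exists_one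
          (p := fun w (y : D.L) => w (0, ()) = D.sq y ∧ (y : K) ∈ D.Tbar T)
          ((TermDefinable.eq (.var _) (.coord_sq D T (.var _))).and
            (TermDefinable.mem_Tbar D T (.var _))),
          fun v => ?_⟩
        change v 0 ∈ D.incl '' D.Tbar T ↔ ∃ y : D.L, D.sqMap (v 0) = D.sq y ∧ (y : K) ∈ D.Tbar T
        constructor
        · rintro ⟨y, hy, h⟩
          exact ⟨⟨y, D.Tbar_subset hT' hy⟩, by rw [← h, ← sqMap_incl], hy⟩
        · rintro ⟨y, hy, hyT⟩
          rw [← sqMap_incl, D.sqMap_injective.eq_iff] at hy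
          exact ⟨y, hyT, hy.symm⟩
  exact hf.isStable h

end Timmesfeld

/-! ### The structure `(L, T̄, ·, σ)` in the group `T · SL₂(L)` -/

namespace Timmesfeld

open Set

variable {K : Type*} [Field K] [CharP K 2] (D : Timmesfeld K) {T : Subgroup (SLTwo K)}

/-- Inside the group, the centralizer of `Diag(s, s⁻¹)` is exactly `T`, and `T̄` parametrizes the
conjugates of `a(1)` under it. -/
lemma mem_Tbar_iff_exists_commute (hT : D.torus ≤ T) (hT' : T ≤ fullTorus K) {s : Kˣ}
    (hs : s ≠ 1) {x : K} :
    x ∈ D.Tbar T ↔ ∃ h : D.group T, h.1 * diagHom K s = diagHom K s * h.1 ∧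
      upperUni x * h.1 = h.1 * upperUni 1 := by
  rw [D.mem_Tbar_iff hT']
  constructor
  · rintro ⟨u, hu, hx⟩
    exact ⟨⟨_, (D.diagHom_mem_group_iff hT hT').2 hu⟩, (commute_diagHom_iff hs).2 ⟨u, rfl⟩,
      upperUni_mul_diagHom_iff.2 hx⟩
  · rintro ⟨⟨h, hG⟩, hh, hx⟩
    obtain ⟨u, rfl⟩ := (commute_diagHom_iff hs).1 hh
    exact ⟨u, (D.diagHom_mem_group_iff hT hT').1 hG, upperUni_mul_diagHom_iff.1 hx⟩

lemma mul_Tbar_iff_exists_commute (hT : D.torus ≤ T) (hT' : T ≤ fullTorus K) {s : Kˣ}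
    (hs : s ≠ 1) {x y z : K} :
    (x ∈ D.Tbar T ∧ y ∈ D.Tbar T ∧ x * y = z) ↔ ∃ h k : D.group T,
      (h.1 * diagHom K s = diagHom K s * h.1 ∧ upperUni x * h.1 = h.1 * upperUni 1) ∧
      (k.1 * diagHom K s = diagHom K s * k.1 ∧ upperUni y * k.1 = k.1 * upperUni 1) ∧
      upperUni z * (h.1 * k.1) = h.1 * k.1 * upperUni 1 := by
  rw [D.mem_Tbar_iff_exists_commute hT hT' hs, D.mem_Tbar_iff_exists_commute hT hT' hs]
  have key {h k : SLTwo K} (hh : h * diagHom K s = diagHom K s * h)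
      (hk : k * diagHom K s = diagHom K s * k) (hx : upperUni x * h = h * upperUni 1)
      (hy : upperUni y * k = k * upperUni 1) :
      x * y = z ↔ upperUni z * (h * k) = h * k * upperUni 1 := by
    obtain ⟨u, rfl⟩ := (commute_diagHom_iff hs).1 hh
    obtain ⟨v, rfl⟩ := (commute_diagHom_iff hs).1 hk
    rw [upperUni_mul_diagHom_iff] at hx hy
    rw [← map_mul, upperUni_mul_diagHom_iff, Units.val_mul, mul_pow, hx, hy]
  constructor
  · rintro ⟨⟨h, hh, hx⟩, ⟨k, hk, hy⟩, e⟩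
    exact ⟨h, k, ⟨hh, hx⟩, ⟨hk, hy⟩, (key hh hk hx hy).1 e⟩
  · rintro ⟨h, k, ⟨hh, hx⟩, ⟨hk, hy⟩, e⟩
    exact ⟨⟨h, hh, hx⟩, ⟨k, hk, hy⟩, (key hh hk hx hy).2 e⟩

lemma upperUni_mul_weyl_conj (x y : K) :
    upperUni x * (weyl K * upperUni y * weyl K) * upperUni x * weyl K =
      upperUni x * lowerUni y * upperUni x * weyl K := by
  rw [weyl_mul_upperUni_mul_weyl]

lemma upperUni_mul_lowerUni_commute {s : Kˣ} (hs : s ≠ 1) {x y : K}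
    (h : upperUni x * lowerUni y * upperUni x * weyl K * diagHom K s =
      diagHom K s * (upperUni x * lowerUni y * upperUni x * weyl K)) : x * y = 1 := by
  obtain ⟨u, hu⟩ := (commute_diagHom_iff hs).1 h
  have h₀₁ := congrArg (fun g : SLTwo K => g 0 1) hu
  simp [SLTwo.mul_apply] at h₀₁
  -- The upper right entry of the product is `1 + xy`, which vanishes in a diagonal matrix.
  linear_combination h₀₁ - CharTwo.two_eq_zero (R := K)

/-- The variable `y` ranges over `A`, the centralizer of `a(1)`, and conjugation by the Weyl element
makes it lower unitriangular. Requiring the product to be diagonal forces it to be `Diag(x, x⁻¹)`,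
which conjugates `a(1)` to `a(x²)`. The first alternative covers `x = 0`. -/
lemma sq_eq_iff_exists_commute (hT : D.torus ≤ T) (hT' : T ≤ fullTorus K) {s : Kˣ}
    (hs : s ≠ 1) {x z : K} (hx : x ∈ D.L) :
    x ^ 2 = z ↔ (upperUni x = 1 ∧ upperUni z = 1) ∨ ∃ y : D.group T,
      y.1 * upperUni 1 = upperUni 1 * y.1 ∧
      upperUni x * (weyl K * y.1 * weyl K) * upperUni x * weyl K * diagHom K s =
        diagHom K s * (upperUni x * (weyl K * y.1 * weyl K) * upperUni x * weyl K) ∧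
      upperUni z * (upperUni x * (weyl K * y.1 * weyl K) * upperUni x * weyl K) =
        upperUni x * (weyl K * y.1 * weyl K) * upperUni x * weyl K * upperUni 1 := by
  constructor
  · intro h
    by_cases hx0 : x = 0
    · refine Or.inl ⟨by rw [hx0, upperUni_zero], ?_⟩
      rw [← h, hx0, zero_pow two_ne_zero, upperUni_zero]
    · refine Or.inr ⟨⟨_, (D.upperUni_mem_group_iff hT hT').2 (D.inv_mem_L hx)⟩, ?_⟩
      simp only [upperUni_mul_weyl_conj]
      have e := upperUni_mul_lowerUni_mul_upperUni (Units.mk0 x hx0)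
      rw [Units.val_mk0] at e
      rw [e, upperUni_mul_diagHom_iff]
      exact ⟨commute_upperUni_one_iff.2 rfl, (commute_diagHom_iff hs).2 ⟨_, rfl⟩, h⟩
  · rintro (⟨h, h'⟩ | ⟨⟨y, hy⟩, hc, h, h'⟩)
    · rw [← upperUni_zero, upperUni_injective.eq_iff] at h h'
      rw [h, h', zero_pow two_ne_zero]
    · rw [commute_upperUni_one_iff] at hc
      simp only at hc h h'
      rw [hc] at h h'
      rw [upperUni_mul_weyl_conj] at h h'
      have hxy := upperUni_mul_lowerUni_commute hs h
      have hx0 : x ≠ 0 := left_ne_zero_of_mul_eq_one hxy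
      have e := upperUni_mul_lowerUni_mul_upperUni (Units.mk0 x hx0)
      rw [Units.val_mk0, ← eq_inv_of_mul_eq_one_right hxy] at e
      rw [e, upperUni_mul_diagHom_iff] at h'
      exact h'

/-- The embedding of `L` as the group of upper unitriangular matrices in `T · SL₂(L)`. -/
def upperEmb (T : Subgroup (SLTwo K)) (t : D.L) : D.group T :=
  ⟨upperUni t, le_sup_right (a := T) (D.upperUni_mem_SL2 t.2)⟩

lemma upperEmb_injective : Function.Injective (D.upperEmb T) := fun _ _ h =>
  Subtype.ext (upperUni_injective (congrArg Subtype.val h))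

lemma upperEmb_add (s t : D.L) : D.upperEmb T (s + t) = D.upperEmb T s * D.upperEmb T t :=
  Subtype.ext (upperUni_add _ _)

lemma upperEmb_zero : D.upperEmb T 0 = 1 := Subtype.ext upperUni_zero

lemma upperEmb_neg (t : D.L) : D.upperEmb T (-t) = (D.upperEmb T t)⁻¹ :=
  Subtype.ext (upperUni_neg _)

lemma exists_unit_ne_one_mem (hK : ¬ PerfectField K) : ∃ s : Kˣ, s ≠ 1 ∧ (s : K) ∈ D.L := by
  obtain ⟨x, hx⟩ := exists_ne_of_not_perfectField hK
  have hx0 : x ≠ 0 := fun h => hx 0 (by rw [h, zero_pow two_ne_zero])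
  -- A nonsquare `x` need not lie in `L`, but `x²` does; `x² = 1` would make `x = 1` a square.
  refine ⟨Units.mk0 x hx0 ^ 2, fun h => hx 1 ?_, by simpa using D.sq_mem x⟩
  have h' : x ^ 2 = 1 ^ 2 := by simpa using congrArg Units.val h
  rw [CharTwo.eq_of_sq_eq_sq h', one_pow]

-- The parameters are `a(1)`, the Weyl element and one nontrivial matrix of `T(L)`. Imperfection of
-- `K` supplies the last one.
attribute [local instance] groupStructure in
theorem isStable_coord_of_group (hK : ¬ PerfectField K) (hT : D.torus ≤ T)
    (hT' : T ≤ fullTorus K) (h : IsStable (groupStructure (D.group T))) :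
    IsStable (D.coordStructure T) := by
  let := D.coordStructure T
  obtain ⟨s, hs, hsL⟩ := D.exists_unit_ne_one_mem hK
  let e : D.group T := D.upperEmb T ⟨1, D.one_mem⟩
  let w : D.group T := ⟨weyl K, le_sup_right (a := T) D.weyl_mem_SL2⟩
  let c : D.group T := ⟨diagHom K s, le_sup_left (b := D.SL2) (D.diagHom_mem hT hsL)⟩
  have const {α : Type} (g : D.group T) :
      (univ : Set (D.group T)).TermDefinable groupLang fun _ : α → D.group T => g :=
    .const_of_mem (mem_univ g)
  have hf : IsInterpretation groupLang coordLang (fun (t : D.L) (_ : Unit) => D.upperEmb T t) := by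
    refine ⟨fun x y hxy => D.upperEmb_injective (congrFun hxy ()), ?_, fun F => ?_, fun R => ?_⟩
    · convert TermDefinable.eq (.group_mul (.var ()) (const e)) (.group_mul (const e) (.var ()))
        using 1
      ext v
      rw [mem_ofPred_eq, Subtype.ext_iff]
      refine Iff.trans ?_ commute_upperUni_one_iff.symm
      constructor
      · rintro ⟨t, rfl⟩
        rfl
      · intro hv
        have hm := (v ()).2
        rw [hv, D.upperUni_mem_group_iff hT hT'] at hm
        exact ⟨⟨_, hm⟩, funext fun _ => Subtype.ext hv.symm⟩
    · cases F with
      | zero =>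
        refine ⟨_, TermDefinable.eq (const 1) (.var (Sum.inr (), ())), fun v => ?_⟩
        change 0 = v (Sum.inr ()) ↔ 1 = D.upperEmb T (v (Sum.inr ()))
        rw [← upperEmb_zero, D.upperEmb_injective.eq_iff]
      | neg =>
        refine ⟨_, TermDefinable.eq (.group_inv (.var (Sum.inl 0, ())))
          (.var (Sum.inr (), ())), fun v => ?_⟩
        change -v (Sum.inl 0) = v (Sum.inr ()) ↔
          (D.upperEmb T (v (Sum.inl 0)))⁻¹ = D.upperEmb T (v (Sum.inr ()))
        rw [← upperEmb_neg, D.upperEmb_injective.eq_iff]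
      | add =>
        refine ⟨_, TermDefinable.eq (.group_mul (.var (Sum.inl 0, ())) (.var (Sum.inl 1, ())))
          (.var (Sum.inr (), ())), fun v => ?_⟩
        change v (Sum.inl 0) + v (Sum.inl 1) = v (Sum.inr ()) ↔
          D.upperEmb T (v (Sum.inl 0)) * D.upperEmb T (v (Sum.inl 1)) =
            D.upperEmb T (v (Sum.inr ()))
        rw [← upperEmb_add, D.upperEmb_injective.eq_iff]
      | sq =>
        refine ⟨_, definable_group_sq e w c (Sum.inl 0, ()) (Sum.inr (), ()), fun v => ?_⟩
        refine Iff.trans ?_ ((D.sq_eq_iff_exists_commute hT hT' hs (v (Sum.inl 0)).2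
          (z := v (Sum.inr ()))).trans ?_)
        · exact Subtype.ext_iff
        · simp only [mem_ofPred_eq, Subtype.ext_iff, Subgroup.coe_mul]
          rfl
    · cases R with
      | torus =>
        refine ⟨_, Definable.exists_one (p := fun v h => h * c = c * h ∧ v (0, ()) * h = h * e)
          (.and (TermDefinable.eq (.group_mul (.var _) (const c)) (.group_mul (const c) (.var _)))
            (TermDefinable.eq (.group_mul (.var _) (.var _)) (.group_mul (.var _) (const e)))),
          fun v => ?_⟩
        refine (D.mem_Tbar_iff_exists_commute hT hT' hs).trans ?_
        simp only [mem_ofPred_eq, Subtype.ext_iff, Subgroup.coe_mul]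
        rfl
      | mul =>
        refine ⟨_, Definable.exists_one (p := fun v h => ∃ k,
          (h * c = c * h ∧ v (0, ()) * h = h * e) ∧ (k * c = c * k ∧ v (1, ()) * k = k * e) ∧
            v (2, ()) * (h * k) = h * k * e) (Definable.exists_one (p := fun v k =>
          (v (Sum.inr ()) * c = c * v (Sum.inr ()) ∧
            v (Sum.inl (0, ())) * v (Sum.inr ()) = v (Sum.inr ()) * e) ∧
          (k * c = c * k ∧ v (Sum.inl (1, ())) * k = k * e) ∧
            v (Sum.inl (2, ())) * (v (Sum.inr ()) * k) = v (Sum.inr ()) * k * e)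
          (.and (.and
            (TermDefinable.eq (.group_mul (.var _) (const c)) (.group_mul (const c) (.var _)))
            (TermDefinable.eq (.group_mul (.var _) (.var _)) (.group_mul (.var _) (const e))))
          (.and (.and
            (TermDefinable.eq (.group_mul (.var _) (const c)) (.group_mul (const c) (.var _)))
            (TermDefinable.eq (.group_mul (.var _) (.var _)) (.group_mul (.var _) (const e))))
            (TermDefinable.eq (.group_mul (.var _) (.group_mul (.var _) (.var _)))
              (.group_mul (.group_mul (.var _) (.var _)) (const e)))))),
          fun v => ?_⟩
        refine (D.mul_Tbar_iff_exists_commute hT hT' hs).trans ?_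
        simp only [mem_ofPred_eq, Subtype.ext_iff, Subgroup.coe_mul]
        rfl
  exact hf.isStable h

/-! ### The group `T · SL₂(L)` in the field `K̃` with predicates -/

lemma incl_eq_of_sq {x : D.tilde} {y : K} (h : x ^ 2 = D.incl (y ^ 2)) : x = D.incl y :=
  CharTwo.eq_of_sq_eq_sq (by rw [h, map_pow])

/-- There is no predicate for `K` in the field structure, and none is needed: `T̄` consists of
squares of elements of `K`, so by uniqueness of square roots an `x ∈ K̃` with `x² ∈ T̄` already lies
in `K`. -/
lemma exists_isTorusEntry_iff (hT' : T ≤ fullTorus K) {x : D.tilde} :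
    (∃ y, IsTorusEntry T y ∧ D.incl y = x) ↔ x = 0 ∨ x * x ∈ D.incl '' D.Tbar T := by
  rw [← pow_two]
  constructor
  · rintro ⟨y, hy, rfl⟩
    rcases (D.isTorusEntry_iff hT').1 hy with rfl | h
    · exact Or.inl (map_zero _)
    · exact Or.inr ⟨_, h, map_pow _ _ _⟩
  · rintro (rfl | ⟨z, hz, h⟩)
    · exact ⟨0, Or.inl rfl, map_zero _⟩
    · obtain ⟨u, hu, rfl⟩ := (D.mem_Tbar_iff hT').1 hz
      exact ⟨u, Or.inr ⟨u, hu, rfl⟩, (D.incl_eq_of_sq h.symm).symm⟩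

/-- A group element is coded by its four entries. The entry conditions define the range of this
coding with the predicates `L` and `T̄`. -/
theorem isStable_group_of_field (hT : D.torus ≤ T) (hT' : T ≤ fullTorus K)
    (h : IsStable (fieldPairStructure D.tilde (D.incl '' D.L) (D.incl '' D.Tbar T))) :
    IsStable (groupStructure (D.group T)) := by
  let := groupStructure (D.group T)
  let := fieldPairStructure D.tilde (D.incl '' D.L) (D.incl '' D.Tbar T)
  have mul {α : Type} {g h : (α → D.tilde) → D.tilde} :=
    TermDefinable.field_mul (D.incl '' D.L) (D.incl '' D.Tbar T) (A := univ) (g := g) (h := h)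
  have add {α : Type} {g h : (α → D.tilde) → D.tilde} :=
    TermDefinable.field_add (D.incl '' D.L) (D.incl '' D.Tbar T) (A := univ) (g := g) (h := h)
  have memL {α : Type} {g : (α → D.tilde) → D.tilde} :=
    TermDefinable.mem_fst (D.incl '' D.L) (D.incl '' D.Tbar T) (A := univ) (g := g)
  have const {α : Type} (x : D.tilde) :
      (univ : Set D.tilde).TermDefinable fieldPairLang fun _ : α → D.tilde => x :=
    .const_of_mem (mem_univ x)
  have inj (g g' : D.group T) :
      g = g' ↔ ∀ p : Fin 2 × Fin 2, D.incl (g.1 p.1 p.2) = D.incl (g'.1 p.1 p.2) :=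
    ⟨fun e p => by rw [e], fun e => Subtype.ext (Matrix.SpecialLinearGroup.ext _ _ fun i j =>
      D.incl.injective (e (i, j)))⟩
  have hf : IsInterpretation fieldPairLang groupLang
      (fun (g : D.group T) (p : Fin 2 × Fin 2) => D.incl (g.1 p.1 p.2)) := by
    refine ⟨fun g g' e => (inj g g').2 (congrFun e), ?_, fun F => ?_, fun R => R.elim⟩
    · convert ((TermDefinable.eq (add (mul (.var (0, 0)) (.var (1, 1)))
        (mul (.var (0, 1)) (.var (1, 0)))) (const 1)).and (Definable.forall_finite
          fun p : Fin 2 × Fin 2 => (TermDefinable.eq (.var p) (const 0)).or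
            (TermDefinable.mem_snd (D.incl '' D.L) (D.incl '' D.Tbar T)
              (mul (.var p) (.var p))))).and ((memL (mul (.var (0, 0)) (.var (0, 1)))).and
        ((memL (mul (.var (1, 0)) (.var (1, 1)))).and
        ((memL (mul (.var (0, 0)) (.var (1, 0)))).and
        (memL (mul (.var (0, 1)) (.var (1, 1))))))) using 1
      ext v
      simp only [← D.exists_isTorusEntry_iff hT']
      constructor
      · rintro ⟨g, rfl⟩
        have hg := (D.mem_group_iff hT hT').1 g.2
        refine ⟨⟨?_, ?_⟩, ⟨_, hg.row, map_mul _ _ _⟩, ⟨_, hg.row', map_mul _ _ _⟩,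
          ⟨_, hg.col, map_mul _ _ _⟩, ⟨_, hg.col', map_mul _ _ _⟩⟩
        · simpa using congrArg D.incl hg.det
        · rintro ⟨i, j⟩
          refine ⟨_, ?_, rfl⟩
          fin_cases i <;> fin_cases j
          exacts [hg.fst, hg.snd, hg.trd, hg.fth]
      · rintro ⟨⟨hdet, hent⟩, hrow, hrow', hcol, hcol'⟩
        choose m hm hmv using hent
        simp only [← hmv, ← map_mul, ← map_add, ← map_one D.incl, D.incl.injective.eq_iff,
          D.incl.injective.mem_set_image] at hdet hrow hrow' hcol hcol'
        let g : SLTwo K := ⟨!![m (0, 0), m (0, 1); m (1, 0), m (1, 1)], by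
          rw [Matrix.det_fin_two_of, CharTwo.sub_eq_add, hdet]⟩
        have hg : g ∈ D.group T := (D.mem_group_iff hT hT').2
          ⟨hdet, hm _, hm _, hm _, hm _, hrow, hrow', hcol, hcol'⟩
        refine ⟨⟨g, hg⟩, funext fun ⟨i, j⟩ => ?_⟩
        rw [← hmv]
        fin_cases i <;> fin_cases j <;> rfl
    · cases F with
      | one =>
        refine ⟨_, Definable.forall_finite fun p : Fin 2 × Fin 2 => TermDefinable.eq
          (const (D.incl ((1 : D.group T).1 p.1 p.2))) (.var (Sum.inr (), p)), fun v => ?_⟩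
        exact inj _ _
      | inv =>
        refine ⟨_, Definable.forall_finite fun p : Fin 2 × Fin 2 => TermDefinable.eq
          (add (mul (.var (Sum.inl 0, (p.1, 0))) (.var (Sum.inr (), (0, p.2))))
            (mul (.var (Sum.inl 0, (p.1, 1))) (.var (Sum.inr (), (1, p.2)))))
          (const (D.incl ((1 : D.group T).1 p.1 p.2))), fun v => ?_⟩
        -- The graph of inversion is expressed by the matrix equation `gh = 1`.
        refine (inv_eq_iff_mul_eq_one (a := v (Sum.inl 0)) (b := v (Sum.inr ()))).trans
          ((inj _ _).trans ?_)
        simp only [Subgroup.coe_mul, SLTwo.mul_apply, map_add, map_mul]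
        rfl
      | mul =>
        refine ⟨_, Definable.forall_finite fun p : Fin 2 × Fin 2 => TermDefinable.eq
          (add (mul (.var (Sum.inl 0, (p.1, 0))) (.var (Sum.inl 1, (0, p.2))))
            (mul (.var (Sum.inl 0, (p.1, 1))) (.var (Sum.inl 1, (1, p.2)))))
          (.var (Sum.inr (), p)), fun v => ?_⟩
        refine (inj (v (Sum.inl 0) * v (Sum.inl 1)) (v (Sum.inr ()))).trans ?_
        simp only [Subgroup.coe_mul, SLTwo.mul_apply, map_add, map_mul]
        rfl
  exact hf.isStable h

end Timmesfeld

/-! ### Changing the predicate on the field -/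

/-- Replacing the second predicate by a definable one preserves stability. -/
theorem IsStable.fieldPair_of_definable {F : Type*} [Field F] {P Q Q' : Set F}
    (h : IsStable (fieldPairStructure F P Q))
    (hQ : letI := fieldPairStructure F P Q
      (Set.univ : Set F).Definable fieldPairLang {v : Fin 1 × Unit → F | v (0, ()) ∈ Q'}) :
    IsStable (fieldPairStructure F P Q') := by
  have hf : @IsInterpretation fieldPairLang fieldPairLang F F Unit (fieldPairStructure F P Q)
      (fieldPairStructure F P Q') (fun x _ => x) := by
    refine @IsInterpretation.mk fieldPairLang fieldPairLang F F Unit (fieldPairStructure F P Q)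
      (fieldPairStructure F P Q') _ (fun x y e => congrFun e ()) ?_ ?_ ?_
    · let := fieldPairStructure F P Q
      convert Set.definable_univ using 1
      exact Set.eq_univ_of_forall fun w => ⟨w (), rfl⟩
    · intro n f
      let := fieldPairStructure F P Q
      refine ⟨_, Set.TermDefinable.eq (.funMap (𝓛 := fieldPairLang) f
        fun i => .var (Sum.inl i, ())) (.var (Sum.inr (), ())), fun v => ?_⟩
      cases f <;> rfl
    · intro n R
      cases R with
      | fst =>
        let := fieldPairStructure F P Q
        exact ⟨_, Set.TermDefinable.mem_fst P Q (.var (0, ())), fun v => Iff.rfl⟩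
      | snd => exact ⟨_, hQ, fun v => Iff.rfl⟩
  exact @IsInterpretation.isStable _ _ _ _ _ (fieldPairStructure F P Q)
    (fieldPairStructure F P Q') _ _ hf h

/-! ### The predicate `⟨L*⟩` for `T = T(L)`, and the equivalence -/

namespace Timmesfeld

open Set

variable {K : Type*} [Field K] [CharP K 2] (D : Timmesfeld K)

lemma unitsGen_overTilde :
    D.overTilde.unitsGen = D.unitsGen.map (Units.map (D.incl : K →* D.tilde)) := by
  rw [unitsGen, unitsGen, MonoidHom.map_closure]
  congr 1
  ext u
  constructor
  · rintro ⟨x, hx, hxu⟩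
    have h0 : x ≠ 0 := fun h => u.ne_zero (by rw [← hxu, h]; exact map_zero D.incl)
    exact ⟨Units.mk0 x h0, hx, Units.ext hxu⟩
  · rintro ⟨x, hx, rfl⟩
    exact ⟨x, hx, rfl⟩

/-- For `T = T(L)` the set `T̄` consists of the squares of `⟨L*⟩`. Each predicate is therefore
definable from the other, as a preimage or as an image under squaring, which is injective on `K̃`.
-/
lemma isStable_field_iff_unitsGen :
    IsStable (fieldPairStructure D.tilde (D.incl '' D.L) (D.incl '' D.Tbar D.torus)) ↔
      IsStable (fieldPairStructure D.tilde (D.incl '' D.L)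
        {x | ∃ u ∈ D.overTilde.unitsGen, x = u}) := by
  have hQ' (x : D.tilde) :
      (∃ u ∈ D.overTilde.unitsGen, x = u) ↔ ∃ u ∈ D.unitsGen, x = D.incl u := by
    rw [unitsGen_overTilde]
    constructor
    · rintro ⟨_, ⟨u, hu, rfl⟩, rfl⟩
      exact ⟨u, hu, rfl⟩
    · rintro ⟨u, hu, rfl⟩
      exact ⟨_, ⟨u, hu, rfl⟩, rfl⟩
  have hQ (x : D.tilde) :
      x ∈ D.incl '' D.Tbar D.torus ↔ ∃ u ∈ D.unitsGen, x = D.incl u * D.incl u := by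
    rw [Tbar_torus]
    constructor
    · rintro ⟨_, ⟨u, hu, rfl⟩, rfl⟩
      exact ⟨u, hu, by rw [map_pow, pow_two]⟩
    · rintro ⟨u, hu, rfl⟩
      exact ⟨_, ⟨u, hu, rfl⟩, by rw [map_pow, pow_two]⟩
  constructor
  · intro h
    refine h.fieldPair_of_definable ?_
    let := fieldPairStructure D.tilde (D.incl '' D.L) (D.incl '' D.Tbar D.torus)
    convert TermDefinable.mem_snd (A := univ) (D.incl '' D.L) (D.incl '' D.Tbar D.torus)
      (.field_mul _ _ (.var ((0 : Fin 1), ())) (.var (0, ()))) using 1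
    ext v
    simp only [mem_ofPred_eq, hQ, hQ', ← pow_two]
    exact exists_congr fun u => and_congr_right fun _ =>
      ⟨fun h => by rw [h], CharTwo.eq_of_sq_eq_sq⟩
  · intro h
    refine h.fieldPair_of_definable ?_
    let := fieldPairStructure D.tilde (D.incl '' D.L) {x | ∃ u ∈ D.overTilde.unitsGen, x = u}
    convert Definable.exists_one (A := univ) (𝓛 := fieldPairLang)
      (p := fun (v : Fin 1 × Unit → D.tilde) y => v (0, ()) = y * y ∧
        y ∈ {x : D.tilde | ∃ u ∈ D.overTilde.unitsGen, x = u})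
      (.and (TermDefinable.eq (.var _) (.field_mul _ _ (.var _) (.var _)))
        (TermDefinable.mem_snd _ _ (.var _))) using 1
    ext v
    simp only [mem_ofPred_eq, hQ, hQ']
    constructor
    · rintro ⟨u, hu, h⟩
      exact ⟨_, h, u, hu, rfl⟩
    · rintro ⟨_, h, u, hu, rfl⟩
      exact ⟨u, hu, h⟩

theorem tfae_isStable (hK : ¬ PerfectField K) {T : Subgroup (SLTwo K)} (hT : D.torus ≤ T)
    (hT' : T ≤ fullTorus K) :
    [IsStable (groupStructure (D.group T)),
      IsStable (D.coordStructure T),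
      IsStable (fieldPairStructure D.tilde (D.incl '' D.L) (D.incl '' D.Tbar T))].TFAE := by
  tfae_have 1 → 2 := D.isStable_coord_of_group hK hT hT'
  tfae_have 2 → 3 := D.isStable_field_of_coord hT hT'
  tfae_have 3 → 1 := D.isStable_group_of_field hT hT'
  tfae_finish

end Timmesfeld

theorem corollary4p10 {K : Type*} [Field K] [CharP K 2] (hK : ¬ PerfectField K)
    (D : Timmesfeld K) :
    -- the equivalence, for every torus `T` between `T(L)` and `T(K)`
    (∀ T : Subgroup (SLTwo K), D.torus ≤ T → T ≤ fullTorus K →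
      D.Tbar T ⊆ D.L ∧
      [IsStable (groupStructure (D.group T)),
        IsStable (D.coordStructure T),
        IsStable (fieldPairStructure D.tilde (D.incl '' D.L) (D.incl '' D.Tbar T))].TFAE ∧
      -- the squaring map defines the field `K̃` in `(L, T̄, ·, σ)`
      ∃ e : D.tilde → D.L, (∀ x, D.incl (e x) = x ^ 2) ∧
        DefinesField (D.coordStructure T) e) ∧
    -- the case of the diagonal subgroup of `SL₂(L)`
    (D.SL2 ⊓ fullTorus K = D.torus ∧
      D.group D.torus = D.SL2 ∧
      D.Tbar D.torus = {a | ∃ u ∈ D.unitsGen, a = (u : K) ^ 2} ∧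
      (IsStable (groupStructure D.SL2) ↔
        IsStable (fieldPairStructure D.tilde (D.incl '' D.L)
          {x | ∃ u ∈ D.overTilde.unitsGen, x = u}))) ∧
    -- `SL₂(L)` in the sense of `K` is `SL₂(L)` in the sense of `K̃`
    (¬ PerfectField D.tilde ∧
      D.SL2.map (Matrix.SpecialLinearGroup.map D.incl) = D.overTilde.SL2) := by
  refine ⟨fun T hT hT' => ⟨D.Tbar_subset hT', D.tfae_isStable hK hT hT', D.sqMap, D.incl_sqMap,
    D.definesField_sqMap hT hT'⟩, ⟨D.SL2_inf_fullTorus, D.group_torus, D.Tbar_torus, ?_⟩,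
    D.not_perfectField_tilde hK, D.map_incl_SL2⟩
  have h := (D.tfae_isStable hK le_rfl D.torus_le_fullTorus).out 0 2
  rw [D.group_torus] at h
  exact h.trans D.isStable_field_iff_unitsGen
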